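/- Let $M$ be a smooth manifold of dimension $d$ (Hausdorff, second countable, without boundary), and let $C^\infty(M)$ be its algebra of real smooth functions. A *star product* on $M$ is an $\mathbb{R}[[\varepsilon]]$-bilinear map $\star$ on $C^\infty(M)[[\varepsilon]]$ such that, for all $f,g,h\in C^\infty(M)$, $$f\star g=fg+\sum_{i\ge 1}B_i(f,g)\,\varepsilon^i,\qquad (f\star g)\star h=f\star(g\star h),\qquad 1\star f=f\star 1=f,$$ where every $B_i$ is a bidifferential operator of globally bounded order: there is $N_i$ such that in all local coordinates $B_i(f,g)=\sum_{|K|,|L|\le N_i}\beta_i^{KL}\,\partial_Kf\,\partial_Lg$ with smooth coefficients $\beta_i^{KL}$. Two star products $\star,\star'$ are *equivalent* if there is an $\mathbb{R}[[\varepsilon]]$-linear operator $\mathcal{D}$ on $C^\infty(M)[[\varepsilon]]$, of the form $\mathcal{D}f=f+\sum_{i\ge1}D_i(f)\,\varepsilon^i$ for $f\in C^\infty(M)$, with $$f\star' g=\mathcal{D}^{-1}(\mathcal{D}f\star\mathcal{D}g).$$ **Lemma.** In every equivalence class of star products on $M$ there is a representative whose first-order term is skew-symmetric. More precisely, for every star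 product $\star$ in the class, with first-order term $B_1$, there are a star product $\star'$ in the class, with first-order term $B_1'$, and an equivalence $\mathcal{D}=\mathrm{id}+\sum_{i\ge1}D_i\,\varepsilon^i$ as above, $f\star' g=\mathcal{D}^{-1}(\mathcal{D}f\star\mathcal{D}g)$, all of whose terms $D_i$ are differential operators of globally bounded order (with smooth coefficients in all local coordinates, the bound depending on $i$), such that for all $f,g\in C^\infty(M)$ $$B_1'(f,g)=-B_1'(g,f),\qquad D_1(fg)=D_1(f)\,g+f\,D_1(g)+\tfrac12\big(B_1(f,g)+B_1(g,f)\big).$$ -/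

import Mathlib

open scoped Manifold ContDiff PowerSeries

noncomputable section

namespace StarProd

/-- The model space `ℝ^d`. -/
abbrev Eucl (d : ℕ) : Type := EuclideanSpace ℝ (Fin d)

/-- The algebra `C^∞(M)` of real smooth functions on a manifold `M` of dimension `d`,
with the pointwise product. -/
abbrev Smooth (d : ℕ) (M : Type*) [TopologicalSpace M] [ChartedSpace (Eucl d) M] : Type _ :=
  C^∞⟮𝓘(ℝ, Eucl d), M; ℝ⟯

/-- The iterated partial derivative `∂_K F = ∂_{k_1} ⋯ ∂_{k_m} F` at `y`, for
`K = (k_1, …, k_m)` a sequence of coordinate directions. -/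
def partialDeriv {d m : ℕ} (K : Fin m → Fin d) (F : Eucl d → ℝ) (y : Eucl d) : ℝ :=
  iteratedFDeriv ℝ m F y (fun j => EuclideanSpace.single (K j) (1 : ℝ))

section Operators

variable {d : ℕ} {M : Type*} [TopologicalSpace M] [ChartedSpace (Eucl d) M]

/-- `P : C^∞(M) → C^∞(M)` is a differential operator of globally bounded order: there is `N`
such that in every smooth local coordinate system `φ` one has `P f = ∑_{|K| ≤ N} a^K ∂_K f` with
smooth coefficients `a^K` (all functions being written in the coordinates `y = φ x`). -/
def IsDifferentialOperator (P : Smooth d M → Smooth d M) : Prop :=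
  ∃ N : ℕ, ∀ φ ∈ IsManifold.maximalAtlas 𝓘(ℝ, Eucl d) ∞ M,
    ∃ a : (m : ℕ) → (Fin m → Fin d) → Eucl d → ℝ,
      (∀ m K, ContDiffOn ℝ ∞ (a m K) φ.target) ∧
      ∀ f : Smooth d M, ∀ y ∈ φ.target,
        P f (φ.symm y) =
          ∑ m ∈ Finset.range (N + 1), ∑ K : Fin m → Fin d,
            a m K y * partialDeriv K (fun z => f (φ.symm z)) y

/-- `B : C^∞(M) × C^∞(M) → C^∞(M)` is a bidifferential operator of globally bounded order: there
is `N` such that in every smooth local coordinate system `φ` one has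
`B(f, g) = ∑_{|K|, |L| ≤ N} β^{KL} ∂_K f ∂_L g` with smooth coefficients `β^{KL}`. -/
def IsBidifferentialOperator (B : Smooth d M → Smooth d M → Smooth d M) : Prop :=
  ∃ N : ℕ, ∀ φ ∈ IsManifold.maximalAtlas 𝓘(ℝ, Eucl d) ∞ M,
    ∃ β : (m : ℕ) → (Fin m → Fin d) → (n : ℕ) → (Fin n → Fin d) → Eucl d → ℝ,
      (∀ m K n L, ContDiffOn ℝ ∞ (β m K n L) φ.target) ∧
      ∀ f g : Smooth d M, ∀ y ∈ φ.target,
        B f g (φ.symm y) =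
          ∑ m ∈ Finset.range (N + 1), ∑ K : Fin m → Fin d,
            ∑ n ∈ Finset.range (N + 1), ∑ L : Fin n → Fin d,
              β m K n L y * partialDeriv K (fun z => f (φ.symm z)) y *
                partialDeriv L (fun z => g (φ.symm z)) y

end Operators

/-- A star product on `M`: an `ℝ⟦ε⟧`-bilinear map on `C^∞(M)⟦ε⟧` of the form
`f ⋆ g = f g + ∑_{i ≥ 1} B_i(f, g) ε^i` for `f, g ∈ C^∞(M)`, associative, with unit `1`, whose
`B_i` are bidifferential operators. -/
structure StarProduct (d : ℕ) (M : Type*) [TopologicalSpace M] [ChartedSpace (Eucl d) M] where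
  /-- The product `f ⋆ g`. -/
  star : (Smooth d M)⟦X⟧ →ₗ[ℝ⟦X⟧] (Smooth d M)⟦X⟧ →ₗ[ℝ⟦X⟧] (Smooth d M)⟦X⟧
  coeff_zero_star : ∀ f g : Smooth d M,
    PowerSeries.coeff 0 (star (PowerSeries.C f) (PowerSeries.C g)) = f * g
  star_assoc : ∀ f g h : Smooth d M,
    star (star (PowerSeries.C f) (PowerSeries.C g)) (PowerSeries.C h) =
      star (PowerSeries.C f) (star (PowerSeries.C g) (PowerSeries.C h))
  one_star : ∀ f : Smooth d M, star 1 (PowerSeries.C f) = PowerSeries.C f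
  star_one : ∀ f : Smooth d M, star (PowerSeries.C f) 1 = PowerSeries.C f
  bidifferential : ∀ i : ℕ, 1 ≤ i → IsBidifferentialOperator
    (fun f g : Smooth d M =>
      PowerSeries.coeff i (star (PowerSeries.C f) (PowerSeries.C g)))

section Equivalence

variable {d : ℕ} {M : Type*} [TopologicalSpace M] [ChartedSpace (Eucl d) M]

/-- The operator `B_i` in `f ⋆ g = f g + ∑_{i ≥ 1} B_i(f, g) ε^i`. -/
def StarProduct.B (S : StarProduct d M) (i : ℕ) (f g : Smooth d M) : Smooth d M :=
  PowerSeries.coeff i (S.star (PowerSeries.C f) (PowerSeries.C g))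

/-- The operator `D_i` in `𝒟 f = ∑_i D_i(f) ε^i`, `f ∈ C^∞(M)`. -/
def term (D : (Smooth d M)⟦X⟧ ≃ₗ[ℝ⟦X⟧] (Smooth d M)⟦X⟧) (i : ℕ) (f : Smooth d M) : Smooth d M :=
  PowerSeries.coeff i (D (PowerSeries.C f))

/-- `𝒟` is an equivalence between `⋆` and `⋆'`: it is of the form `𝒟 f = f + ∑_{i ≥ 1} D_i(f) ε^i`
and `f ⋆' g = 𝒟⁻¹ (𝒟 f ⋆ 𝒟 g)`. (An `ℝ⟦ε⟧`-linear operator of this form is always invertible.) -/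
def IsEquivalence (D : (Smooth d M)⟦X⟧ ≃ₗ[ℝ⟦X⟧] (Smooth d M)⟦X⟧) (S S' : StarProduct d M) : Prop :=
  (∀ f : Smooth d M, term D 0 f = f) ∧
    ∀ f g : (Smooth d M)⟦X⟧, S'.star f g = D.symm (S.star (D f) (D g))

/-- Two star products are equivalent if there is an equivalence between them. -/
def Equivalent (S S' : StarProduct d M) : Prop :=
  ∃ D : (Smooth d M)⟦X⟧ ≃ₗ[ℝ⟦X⟧] (Smooth d M)⟦X⟧, IsEquivalence D S S'

theorem coeff_zero_of_term_zero {D : (Smooth d M)⟦X⟧ ≃ₗ[ℝ⟦X⟧] (Smooth d M)⟦X⟧}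
    (h : ∀ f : Smooth d M, term D 0 f = f) (p : (Smooth d M)⟦X⟧) :
    PowerSeries.coeff 0 (D p) = PowerSeries.coeff 0 p := by
  have hX : ∀ q : (Smooth d M)⟦X⟧, (PowerSeries.X : ℝ⟦X⟧) • q = PowerSeries.X * q := by
    intro q
    rw [Algebra.smul_def]
    congr 1
    exact PowerSeries.map_X _
  obtain ⟨q, hq⟩ : ∃ q : (Smooth d M)⟦X⟧,
      p = (PowerSeries.X : ℝ⟦X⟧) • q + PowerSeries.C (PowerSeries.coeff 0 p) := by
    refine ⟨PowerSeries.mk fun n => PowerSeries.coeff (n + 1) p, ?_⟩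
    rw [hX]
    simpa using PowerSeries.eq_X_mul_shift_add_const p
  have h0 := h (PowerSeries.coeff 0 p)
  unfold term at h0
  conv_lhs => rw [hq]
  rw [map_add, map_smul, hX, map_add, h0]
  simp

theorem equivalent_equivalence : _root_.Equivalence (Equivalent (d := d) (M := M)) where
  refl S := ⟨LinearEquiv.refl _ _, by intro f; simp [term], by intro f g; rfl⟩
  symm := by
    rintro S S' ⟨D, h0, h⟩
    refine ⟨D.symm, ?_, ?_⟩
    · intro f
      have := coeff_zero_of_term_zero h0 (D.symm (PowerSeries.C f))
      unfold term
      rw [← this]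
      simp
    · intro f g
      rw [h]
      simp
  trans := by
    rintro S S' S'' ⟨D, h0, h⟩ ⟨D', h0', h'⟩
    refine ⟨D'.trans D, ?_, ?_⟩
    · intro f
      have := coeff_zero_of_term_zero h0 (D' (PowerSeries.C f))
      unfold term
      rw [LinearEquiv.trans_apply, this]
      exact h0' f
    · intro f g
      rw [h', h]
      simp

/-- Equivalence of star products on `M`. -/
def setoid (d : ℕ) (M : Type*) [TopologicalSpace M] [ChartedSpace (Eucl d) M] :
    Setoid (StarProduct d M) :=
  ⟨Equivalent, equivalent_equivalence⟩

end Equivalence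

end StarProd

end

/-! The order-`ε` part of associativity says that `B_1` is a Hochschild 2-cocycle on `C^∞(M)`. So is
its symmetric part `B`, and unitality makes `B` vanish on constants. If `B` has a primitive, a
differential operator `D` with `D(fg) = D(f) g + f D(g) + B(f,g)`, then conjugating `⋆` by `id + ε
D` subtracts `B` from `B_1` and leaves the skew part. So everything reduces to showing that a
symmetric bidifferential cocycle is the coboundary of a differential operator.

Locally this is a Poincaré lemma on symbols (`symmetric_cocycle_eq_coboundary`). Fix a point `y` and
coordinates `x_l` centred there. A primitive should satisfy `D(x_l F)(y) = B(F, x_l)(y)`; on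
symbols, multiplication by `x_l` is `∂/∂ξ_l`, so the contractions `B(·, x_l)` prescribe the gradient
of the symbol of `D`. The cocycle identity and symmetry make this prescribed 1-form closed, and the
radial homotopy integrates it: the part of degree `m` is paired with `ξ_l` and divided by `m + 1`,
which is `cocyclePrimitive`. Hadamard's lemma then reduces the coboundary equation for `(F, G)` to
`G = x_l g`, where it is again the cocycle identity. The formula is explicit in the coefficients of
`B`, so it gives a smooth differential operator in each chart (`cocyclePrimitive_mul_chart`).

Globally, the equation for `D` is affine, so a partition of unity glues the chart primitives
(`exists_linear_primitive`). That the result is a differential operator in every chart, with one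
bound on the order, needs no change-of-coordinates formula: in any chart it differs from the
explicit primitive by a derivation at each point, that is, by a first-order operator
(`isDifferentialOperator_of_coboundary`). -/

noncomputable section

namespace StarProd

open Filter Topology
open Finset.HasAntidiagonal (antidiagonal)

/-! ### Calculus of differential and bidifferential operators on subsets of `ℝ^d`. -/

section LocalOperators

variable {d : ℕ}

/-- The partial derivative `∂_i F`. -/
def dirDeriv (i : Fin d) (F : Eucl d → ℝ) (y : Eucl d) : ℝ :=
  fderiv ℝ F y (EuclideanSpace.single i (1 : ℝ))

theorem partialDeriv_congr {m : ℕ} {K : Fin m → Fin d} {F G : Eucl d → ℝ} {y : Eucl d}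
    (h : F =ᶠ[𝓝 y] G) : partialDeriv K F y = partialDeriv K G y := by
  unfold partialDeriv
  rw [(h.iteratedFDeriv ℝ m).eq_of_nhds]

theorem dirDeriv_congr {i : Fin d} {F G : Eucl d → ℝ} {y : Eucl d}
    (h : F =ᶠ[𝓝 y] G) : dirDeriv i F y = dirDeriv i G y := by
  unfold dirDeriv
  rw [h.fderiv_eq]

@[simp]
theorem partialDeriv_zero (K : Fin 0 → Fin d) (F : Eucl d → ℝ) (y : Eucl d) :
    partialDeriv K F y = F y := by
  simp [partialDeriv]

theorem partialDeriv_succ {m : ℕ} (K : Fin (m + 1) → Fin d) {F : Eucl d → ℝ} {y : Eucl d}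
    (h : ContDiffAt ℝ ∞ F y) :
    partialDeriv K F y = dirDeriv (K 0) (partialDeriv (Fin.tail K) F) y := by
  have hd : DifferentiableAt ℝ (iteratedFDeriv ℝ m F) y :=
    h.differentiableAt_iteratedFDeriv (by exact_mod_cast ENat.natCast_lt_top m)
  unfold dirDeriv partialDeriv
  rw [iteratedFDeriv_succ_apply_left, fderiv_continuousMultilinear_apply_const_apply hd]
  rfl

theorem contDiffAt_partialDeriv {m : ℕ} (K : Fin m → Fin d) {F : Eucl d → ℝ} {y : Eucl d}
    (h : ContDiffAt ℝ ∞ F y) : ContDiffAt ℝ ∞ (partialDeriv K F) y := by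
  have := h.iteratedFDeriv_right (m := ∞) (i := m) (le_of_eq rfl)
  exact (ContinuousMultilinearMap.apply ℝ (fun _ : Fin m => Eucl d) ℝ
    (fun j => EuclideanSpace.single (K j) (1 : ℝ))).contDiff.contDiffAt.comp y this

theorem contDiffAt_dirDeriv (i : Fin d) {F : Eucl d → ℝ} {y : Eucl d}
    (h : ContDiffAt ℝ ∞ F y) : ContDiffAt ℝ ∞ (dirDeriv i F) y :=
  (h.fderiv_right (m := ∞) (by simp)).clm_apply contDiffAt_const

theorem dirDeriv_add (i : Fin d) {F G : Eucl d → ℝ} {y : Eucl d}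
    (hF : ContDiffAt ℝ ∞ F y) (hG : ContDiffAt ℝ ∞ G y) :
    dirDeriv i (fun z => F z + G z) y = dirDeriv i F y + dirDeriv i G y := by
  unfold dirDeriv
  rw [fderiv_fun_add (hF.differentiableAt (by simp)) (hG.differentiableAt (by simp))]
  rfl

theorem dirDeriv_sum (i : Fin d) {ι : Type*} (s : Finset ι) {F : ι → Eucl d → ℝ} {y : Eucl d}
    (hF : ∀ j ∈ s, ContDiffAt ℝ ∞ (F j) y) :
    dirDeriv i (fun z => ∑ j ∈ s, F j z) y = ∑ j ∈ s, dirDeriv i (F j) y := by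
  unfold dirDeriv
  rw [fderiv_fun_sum fun j hj => (hF j hj).differentiableAt (by simp)]
  simp

theorem dirDeriv_mul (i : Fin d) {F G : Eucl d → ℝ} {y : Eucl d}
    (hF : ContDiffAt ℝ ∞ F y) (hG : ContDiffAt ℝ ∞ G y) :
    dirDeriv i (fun z => F z * G z) y = dirDeriv i F y * G y + F y * dirDeriv i G y := by
  unfold dirDeriv
  rw [fderiv_fun_mul (hF.differentiableAt (by simp)) (hG.differentiableAt (by simp))]
  simp; ring

theorem dirDeriv_const (i : Fin d) (c : ℝ) (y : Eucl d) : dirDeriv i (fun _ => c) y = 0 := by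
  simp [dirDeriv]

theorem partialDeriv_add {m : ℕ} (K : Fin m → Fin d) {F G : Eucl d → ℝ} {y : Eucl d}
    (hF : ContDiffAt ℝ ∞ F y) (hG : ContDiffAt ℝ ∞ G y) :
    partialDeriv K (fun z => F z + G z) y = partialDeriv K F y + partialDeriv K G y := by
  unfold partialDeriv
  have := iteratedFDeriv_add_apply (i := m) (hF.of_le (by exact_mod_cast le_top))
    (hG.of_le (by exact_mod_cast le_top))
  change iteratedFDeriv ℝ m (F + G) y _ = _
  rw [this]
  rfl

theorem partialDeriv_const_mul {m : ℕ} (K : Fin m → Fin d) (c : ℝ) {F : Eucl d → ℝ} {y : Eucl d}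
    (hF : ContDiffAt ℝ ∞ F y) :
    partialDeriv K (fun z => c * F z) y = c * partialDeriv K F y := by
  unfold partialDeriv
  have := iteratedFDeriv_const_smul_apply (i := m) (a := c) (hF.of_le (by exact_mod_cast le_top))
  change iteratedFDeriv ℝ m (c • F) y _ = _
  rw [this]
  rfl

/-- `T` is, on smooth functions on `U`, a linear differential operator of order at most `N` with
smooth coefficients. -/
def LocalDO (U : Set (Eucl d)) (N : ℕ) (T : (Eucl d → ℝ) → Eucl d → ℝ) : Prop :=
  ∃ a : (m : ℕ) → (Fin m → Fin d) → Eucl d → ℝ,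
    (∀ m K, ContDiffOn ℝ ∞ (a m K) U) ∧
    ∀ F, ContDiffOn ℝ ∞ F U → ∀ y ∈ U,
      T F y = ∑ m ∈ Finset.range (N + 1), ∑ K : Fin m → Fin d, a m K y * partialDeriv K F y

/-- `T` is, on smooth functions on `U`, a bidifferential operator of order at most `N` with smooth
coefficients. -/
def LocalBiDO (U : Set (Eucl d)) (N : ℕ)
    (T : (Eucl d → ℝ) → (Eucl d → ℝ) → Eucl d → ℝ) : Prop :=
  ∃ β : (m : ℕ) → (Fin m → Fin d) → (n : ℕ) → (Fin n → Fin d) → Eucl d → ℝ,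
    (∀ m K n L, ContDiffOn ℝ ∞ (β m K n L) U) ∧
    ∀ F G, ContDiffOn ℝ ∞ F U → ContDiffOn ℝ ∞ G U → ∀ y ∈ U,
      T F G y =
        ∑ m ∈ Finset.range (N + 1), ∑ K : Fin m → Fin d,
          ∑ n ∈ Finset.range (N + 1), ∑ L : Fin n → Fin d,
            β m K n L y * partialDeriv K F y * partialDeriv L G y

variable {U : Set (Eucl d)} {N N' : ℕ}

theorem contDiffOn_partialDeriv {m : ℕ} (K : Fin m → Fin d) {F : Eucl d → ℝ} (hU : IsOpen U)
    (h : ContDiffOn ℝ ∞ F U) : ContDiffOn ℝ ∞ (partialDeriv K F) U := fun _ hy =>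
  (contDiffAt_partialDeriv K (h.contDiffAt (hU.mem_nhds hy))).contDiffWithinAt

theorem contDiffOn_dirDeriv (i : Fin d) {F : Eucl d → ℝ} (hU : IsOpen U)
    (h : ContDiffOn ℝ ∞ F U) : ContDiffOn ℝ ∞ (dirDeriv i F) U := fun _ hy =>
  (contDiffAt_dirDeriv i (h.contDiffAt (hU.mem_nhds hy))).contDiffWithinAt

namespace LocalDO

variable {S T : (Eucl d → ℝ) → Eucl d → ℝ}

theorem congr (hS : LocalDO U N S)
    (h : ∀ F, ContDiffOn ℝ ∞ F U → ∀ y ∈ U, T F y = S F y) : LocalDO U N T := by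
  obtain ⟨a, ha, h'⟩ := hS
  exact ⟨a, ha, fun F hF y hy => (h F hF y hy).trans (h' F hF y hy)⟩

theorem contDiffOn (hU : IsOpen U) (hT : LocalDO U N T) {F : Eucl d → ℝ}
    (hF : ContDiffOn ℝ ∞ F U) : ContDiffOn ℝ ∞ (T F) U := by
  obtain ⟨a, ha, h⟩ := hT
  refine ContDiffOn.congr ?_ (h F hF)
  exact ContDiffOn.sum fun m _ => ContDiffOn.sum fun K _ =>
    (ha m K).mul (contDiffOn_partialDeriv K hU hF)

/-- Locality: only the germ at the point matters. This is what lets global functions on `M` and on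
`ℝ^d` be exchanged later. -/
theorem congr_fun (hT : LocalDO U N T) {F G : Eucl d → ℝ}
    (hF : ContDiffOn ℝ ∞ F U) (hG : ContDiffOn ℝ ∞ G U) {y : Eucl d} (hy : y ∈ U)
    (h : F =ᶠ[𝓝 y] G) : T F y = T G y := by
  obtain ⟨a, ha, h'⟩ := hT
  rw [h' F hF y hy, h' G hG y hy]
  simp only [partialDeriv_congr h]

theorem map_add (hU : IsOpen U) (hT : LocalDO U N T) {F G : Eucl d → ℝ}
    (hF : ContDiffOn ℝ ∞ F U) (hG : ContDiffOn ℝ ∞ G U) {y : Eucl d} (hy : y ∈ U) :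
    T (fun z => F z + G z) y = T F y + T G y := by
  obtain ⟨a, ha, h⟩ := hT
  rw [h _ (hF.add hG) y hy, h F hF y hy, h G hG y hy]
  simp only [partialDeriv_add _ (hF.contDiffAt (hU.mem_nhds hy)) (hG.contDiffAt (hU.mem_nhds hy)),
    mul_add, Finset.sum_add_distrib]

theorem map_const_mul (hU : IsOpen U) (hT : LocalDO U N T) (c : ℝ) {F : Eucl d → ℝ}
    (hF : ContDiffOn ℝ ∞ F U) {y : Eucl d} (hy : y ∈ U) :
    T (fun z => c * F z) y = c * T F y := by
  obtain ⟨a, ha, h⟩ := hT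
  rw [h _ (contDiffOn_const.mul hF) y hy, h F hF y hy]
  simp only [partialDeriv_const_mul _ c (hF.contDiffAt (hU.mem_nhds hy)), Finset.mul_sum,
    mul_left_comm c]

theorem zero : LocalDO U N (fun _ _ => 0) :=
  ⟨fun _ _ _ => 0, fun _ _ => contDiffOn_const, by simp⟩

theorem add (hS : LocalDO U N S) (hT : LocalDO U N T) :
    LocalDO U N (fun F y => S F y + T F y) := by
  obtain ⟨a, ha, h⟩ := hS
  obtain ⟨b, hb, h'⟩ := hT
  refine ⟨fun m K y => a m K y + b m K y, fun m K => (ha m K).add (hb m K), ?_⟩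
  intro F hF y hy
  beta_reduce
  rw [h F hF y hy, h' F hF y hy]
  simp only [add_mul, Finset.sum_add_distrib]

theorem sum {ι : Type*} (s : Finset ι) {T : ι → (Eucl d → ℝ) → Eucl d → ℝ}
    (h : ∀ i ∈ s, LocalDO U N (T i)) : LocalDO U N (fun F y => ∑ i ∈ s, T i F y) := by
  classical
  induction s using Finset.induction_on with
  | empty => simpa using zero
  | insert i s hi ih =>
    simp only [Finset.sum_insert hi]
    exact (h i (Finset.mem_insert_self i s)).add
      (ih fun j hj => h j (Finset.mem_insert_of_mem hj))

theorem smul {c : Eucl d → ℝ} (hc : ContDiffOn ℝ ∞ c U) (hT : LocalDO U N T) :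
    LocalDO U N (fun F y => c y * T F y) := by
  obtain ⟨a, ha, h⟩ := hT
  refine ⟨fun m K y => c y * a m K y, fun m K => hc.mul (ha m K), ?_⟩
  intro F hF y hy
  beta_reduce
  rw [h F hF y hy]
  simp only [Finset.mul_sum, mul_assoc]

theorem partialDeriv {m : ℕ} (K : Fin m → Fin d) (hm : m ≤ N) :
    LocalDO U N (partialDeriv K) := by
  classical
  -- The length of `L` depends on `n`, so the indicator of the single term `K` compares elements of
  -- the sigma type.
  refine ⟨fun n L _ => if (⟨n, L⟩ : Σ n, Fin n → Fin d) = ⟨m, K⟩ then 1 else 0,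
    fun _ _ => contDiffOn_const, ?_⟩
  intro F hF y hy
  rw [Finset.sum_eq_single_of_mem m (by simp; omega), Finset.sum_eq_single_of_mem K (by simp)]
  · simp
  · intro L _ hL
    simp [hL]
  · intro n _ hn
    refine Finset.sum_eq_zero fun L _ => ?_
    simp [hn]

theorem id : LocalDO U N (fun F => F) :=
  (partialDeriv (Fin.elim0 : Fin 0 → Fin d) (Nat.zero_le _)).congr
    fun F _ y _ => (partialDeriv_zero _ F y).symm

theorem mono (hT : LocalDO U N T) (h : N ≤ N') : LocalDO U N' T := by
  obtain ⟨a, ha, h'⟩ := hT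
  refine congr (S := fun F y => ∑ m ∈ Finset.range (N + 1), ∑ K : Fin m → Fin d,
    a m K y * StarProd.partialDeriv K F y) ?_ h'
  refine sum _ fun m hm => sum _ fun K _ => smul (ha m K) (partialDeriv K ?_)
  simp at hm; omega

/-- Leibniz: the new derivative either falls on the coefficient or is prepended to the multi-index
by `Fin.cons`, which costs one order. -/
theorem dirDeriv (hU : IsOpen U) (i : Fin d) (hT : LocalDO U N T) :
    LocalDO U (N + 1) (fun F y => dirDeriv i (T F) y) := by
  obtain ⟨a, ha, h⟩ := hT
  have key : LocalDO U (N + 1) (fun F y => ∑ m ∈ Finset.range (N + 1), ∑ K : Fin m → Fin d,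
      (StarProd.dirDeriv i (a m K) y * StarProd.partialDeriv K F y +
        a m K y * StarProd.partialDeriv (Fin.cons i K : Fin (m + 1) → Fin d) F y)) := by
    refine sum _ fun m hm => sum _ fun K _ => ?_
    have hm : m ≤ N := by simp at hm; omega
    exact (smul (contDiffOn_dirDeriv i hU (ha m K)) (partialDeriv K (by omega))).add
      (smul (ha m K) (partialDeriv (Fin.cons i K) (by omega)))
  refine key.congr fun F hF y hy => ?_
  have hFy := hF.contDiffAt (hU.mem_nhds hy)
  have hay := fun m K => (ha m K).contDiffAt (hU.mem_nhds hy)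
  rw [dirDeriv_congr (G := fun y => ∑ m ∈ Finset.range (N + 1), ∑ K : Fin m → Fin d,
    a m K y * StarProd.partialDeriv K F y)
    (Filter.eventually_of_mem (hU.mem_nhds hy) (h F hF))]
  rw [dirDeriv_sum i _ fun m _ => ContDiffAt.sum fun K _ =>
    (hay m K).mul (contDiffAt_partialDeriv K hFy)]
  refine Finset.sum_congr rfl fun m _ => ?_
  rw [dirDeriv_sum i _ fun K _ => (hay m K).mul (contDiffAt_partialDeriv K hFy)]
  refine Finset.sum_congr rfl fun K _ => ?_
  rw [dirDeriv_mul i (hay m K) (contDiffAt_partialDeriv K hFy), partialDeriv_succ _ hFy]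
  simp

theorem partialDeriv_comp (hU : IsOpen U) {m : ℕ} (K : Fin m → Fin d) (hT : LocalDO U N T) :
    LocalDO U (N + m) (fun F y => StarProd.partialDeriv K (T F) y) := by
  induction m with
  | zero => simpa using hT
  | succ m ih =>
    refine ((ih (Fin.tail K)).dirDeriv hU (K 0)).congr fun F hF y hy => ?_
    exact partialDeriv_succ K ((hT.contDiffOn hU hF).contDiffAt (hU.mem_nhds hy))

theorem comp (hU : IsOpen U) (hS : LocalDO U N' S) (hT : LocalDO U N T) :
    LocalDO U (N + N') (fun F y => S (T F) y) := by
  obtain ⟨a, ha, h⟩ := hS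
  refine congr (S := fun F y => ∑ m ∈ Finset.range (N' + 1), ∑ K : Fin m → Fin d,
    a m K y * StarProd.partialDeriv K (T F) y) ?_
    fun F hF y hy => h (T F) (hT.contDiffOn hU hF) y hy
  refine sum _ fun m hm => sum _ fun K _ => smul (ha m K) ((hT.partialDeriv_comp hU K).mono ?_)
  simp at hm; omega

end LocalDO

namespace LocalBiDO

variable {T T' : (Eucl d → ℝ) → (Eucl d → ℝ) → Eucl d → ℝ}

theorem congr (hT' : LocalBiDO U N T')
    (h : ∀ F G, ContDiffOn ℝ ∞ F U → ContDiffOn ℝ ∞ G U → ∀ y ∈ U, T F G y = T' F G y) :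
    LocalBiDO U N T := by
  obtain ⟨a, ha, h'⟩ := hT'
  exact ⟨a, ha, fun F G hF hG y hy => (h F G hF hG y hy).trans (h' F G hF hG y hy)⟩

theorem congr_fun (hT : LocalBiDO U N T) {F F' G G' : Eucl d → ℝ}
    (hF : ContDiffOn ℝ ∞ F U) (hF' : ContDiffOn ℝ ∞ F' U) (hG : ContDiffOn ℝ ∞ G U)
    (hG' : ContDiffOn ℝ ∞ G' U) {y : Eucl d} (hy : y ∈ U) (h : F =ᶠ[𝓝 y] F')
    (h' : G =ᶠ[𝓝 y] G') : T F G y = T F' G' y := by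
  obtain ⟨a, ha, hT⟩ := hT
  rw [hT F G hF hG y hy, hT F' G' hF' hG' y hy]
  simp only [partialDeriv_congr h, partialDeriv_congr h']

theorem zero : LocalBiDO U N (fun _ _ _ => 0) :=
  ⟨fun _ _ _ _ _ => 0, fun _ _ _ _ => contDiffOn_const, by simp⟩

theorem add (hT : LocalBiDO U N T) (hT' : LocalBiDO U N T') :
    LocalBiDO U N (fun F G y => T F G y + T' F G y) := by
  obtain ⟨a, ha, h⟩ := hT
  obtain ⟨b, hb, h'⟩ := hT'
  refine ⟨fun m K n L y => a m K n L y + b m K n L y,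
    fun m K n L => (ha m K n L).add (hb m K n L), ?_⟩
  intro F G hF hG y hy
  beta_reduce
  rw [h F G hF hG y hy, h' F G hF hG y hy]
  simp only [add_mul, Finset.sum_add_distrib]

theorem sum {ι : Type*} (s : Finset ι) {T : ι → (Eucl d → ℝ) → (Eucl d → ℝ) → Eucl d → ℝ}
    (h : ∀ i ∈ s, LocalBiDO U N (T i)) : LocalBiDO U N (fun F G y => ∑ i ∈ s, T i F G y) := by
  classical
  induction s using Finset.induction_on with
  | empty => simpa using zero
  | insert i s hi ih =>
    simp only [Finset.sum_insert hi]
    exact (h i (Finset.mem_insert_self i s)).add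
      (ih fun j hj => h j (Finset.mem_insert_of_mem hj))

theorem smul {c : Eucl d → ℝ} (hc : ContDiffOn ℝ ∞ c U) (hT : LocalBiDO U N T) :
    LocalBiDO U N (fun F G y => c y * T F G y) := by
  obtain ⟨a, ha, h⟩ := hT
  refine ⟨fun m K n L y => c y * a m K n L y, fun m K n L => hc.mul (ha m K n L), ?_⟩
  intro F G hF hG y hy
  beta_reduce
  rw [h F G hF hG y hy]
  simp only [Finset.mul_sum, mul_assoc]

theorem mul {S S' : (Eucl d → ℝ) → Eucl d → ℝ} (hS : LocalDO U N S) (hS' : LocalDO U N S') :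
    LocalBiDO U N (fun F G y => S F y * S' G y) := by
  obtain ⟨a, ha, h⟩ := hS
  obtain ⟨b, hb, h'⟩ := hS'
  refine ⟨fun m K n L y => a m K y * b n L y, fun m K n L => (ha m K).mul (hb n L), ?_⟩
  intro F G hF hG y hy
  beta_reduce
  rw [h F hF y hy, h' G hG y hy]
  simp only [Finset.sum_mul]
  simp only [Finset.mul_sum]
  refine Finset.sum_congr rfl fun m _ => Finset.sum_congr rfl fun K _ =>
    Finset.sum_congr rfl fun n _ => Finset.sum_congr rfl fun L _ => ?_
  ring

theorem swap (hT : LocalBiDO U N T) : LocalBiDO U N (fun F G y => T G F y) := by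
  obtain ⟨a, ha, h⟩ := hT
  refine ⟨fun m K n L y => a n L m K y, fun m K n L => ha n L m K, ?_⟩
  intro F G hF hG y hy
  have step : ∀ m ∈ Finset.range (N + 1), ∑ K : Fin m → Fin d,
      ∑ n ∈ Finset.range (N + 1), ∑ L : Fin n → Fin d,
        a n L m K y * StarProd.partialDeriv K F y * StarProd.partialDeriv L G y =
      ∑ n ∈ Finset.range (N + 1), ∑ L : Fin n → Fin d, ∑ K : Fin m → Fin d,
        a n L m K y * StarProd.partialDeriv L G y * StarProd.partialDeriv K F y := by
    intro m _
    rw [Finset.sum_comm]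
    refine Finset.sum_congr rfl fun n _ => ?_
    rw [Finset.sum_comm]
    exact Finset.sum_congr rfl fun _ _ => Finset.sum_congr rfl fun _ _ => by ring
  beta_reduce
  rw [h G F hG hF y hy, Finset.sum_congr rfl step, Finset.sum_comm]
  refine Finset.sum_congr rfl fun n _ => ?_
  rw [Finset.sum_comm]

theorem comp (hU : IsOpen U) {S S' : (Eucl d → ℝ) → Eucl d → ℝ} {N₁ : ℕ}
    (hT : LocalBiDO U N₁ T) (hS : LocalDO U N S) (hS' : LocalDO U N S') :
    LocalBiDO U (N + N₁) (fun F G y => T (S F) (S' G) y) := by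
  obtain ⟨a, ha, h⟩ := hT
  refine congr (T' := fun F G y => ∑ m ∈ Finset.range (N₁ + 1), ∑ K : Fin m → Fin d,
    ∑ n ∈ Finset.range (N₁ + 1), ∑ L : Fin n → Fin d, a m K n L y *
      (StarProd.partialDeriv K (S F) y * StarProd.partialDeriv L (S' G) y)) ?_ ?_
  · refine sum _ fun m hm => sum _ fun K _ => sum _ fun n hn => sum _ fun L _ =>
      smul (ha m K n L) (mul ((hS.partialDeriv_comp hU K).mono ?_)
        ((hS'.partialDeriv_comp hU L).mono ?_))
    · simp at hm; omega
    · simp at hn; omega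
  · intro F G hF hG y hy
    rw [h _ _ (hS.contDiffOn hU hF) (hS'.contDiffOn hU hG) y hy]
    simp only [mul_assoc]

theorem mono (hU : IsOpen U) (hT : LocalBiDO U N T) (h : N ≤ N') : LocalBiDO U N' T := by
  -- Precomposing with the identity, declared to have order `N' - N`, raises the nominal order
  -- without touching the sums.
  have := hT.comp hU (LocalDO.id (N := N' - N)) (LocalDO.id (N := N' - N))
  rwa [Nat.sub_add_cancel h] at this

theorem contDiffOn (hU : IsOpen U) (hT : LocalBiDO U N T) {F G : Eucl d → ℝ}
    (hF : ContDiffOn ℝ ∞ F U) (hG : ContDiffOn ℝ ∞ G U) : ContDiffOn ℝ ∞ (T F G) U := by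
  obtain ⟨a, ha, h⟩ := hT
  refine ContDiffOn.congr ?_ (h F G hF hG)
  exact ContDiffOn.sum fun m _ => ContDiffOn.sum fun K _ => ContDiffOn.sum fun n _ =>
    ContDiffOn.sum fun L _ => ((ha m K n L).mul (contDiffOn_partialDeriv K hU hF)).mul
      (contDiffOn_partialDeriv L hU hG)

theorem dirDeriv (hU : IsOpen U) (i : Fin d) (hT : LocalBiDO U N T) :
    LocalBiDO U (N + 1) (fun F G y => dirDeriv i (T F G) y) := by
  obtain ⟨a, ha, h⟩ := hT
  have key : LocalBiDO U (N + 1) (fun F G y => ∑ m ∈ Finset.range (N + 1), ∑ K : Fin m → Fin d,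
      ∑ n ∈ Finset.range (N + 1), ∑ L : Fin n → Fin d,
      (StarProd.dirDeriv i (a m K n L) y *
          (StarProd.partialDeriv K F y * StarProd.partialDeriv L G y) +
        (a m K n L y * (StarProd.partialDeriv (Fin.cons i K : Fin (m + 1) → Fin d) F y *
          StarProd.partialDeriv L G y) +
        a m K n L y * (StarProd.partialDeriv K F y *
          StarProd.partialDeriv (Fin.cons i L : Fin (n + 1) → Fin d) G y)))) := by
    refine sum _ fun m hm => sum _ fun K _ => sum _ fun n hn => sum _ fun L _ => ?_
    have hm : m ≤ N := by simp at hm; omega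
    have hn : n ≤ N := by simp at hn; omega
    have hp : ∀ {k : ℕ} (J : Fin k → Fin d), k ≤ N + 1 →
      LocalDO U (N + 1) (StarProd.partialDeriv J) := fun J hk => LocalDO.partialDeriv J hk
    exact (smul (contDiffOn_dirDeriv i hU (ha m K n L))
        (mul (hp K (by omega)) (hp L (by omega)))).add
      ((smul (ha m K n L) (mul (hp _ (by omega)) (hp L (by omega)))).add
        (smul (ha m K n L) (mul (hp K (by omega)) (hp _ (by omega)))))
  refine key.congr fun F G hF hG y hy => ?_
  have hFy := hF.contDiffAt (hU.mem_nhds hy)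
  have hGy := hG.contDiffAt (hU.mem_nhds hy)
  have hs : ∀ m (K : Fin m → Fin d) n (L : Fin n → Fin d), ContDiffAt ℝ ∞
      (fun y => a m K n L y * StarProd.partialDeriv K F y * StarProd.partialDeriv L G y) y :=
    fun m K n L => (((ha m K n L).contDiffAt (hU.mem_nhds hy)).mul
      (contDiffAt_partialDeriv K hFy)).mul (contDiffAt_partialDeriv L hGy)
  rw [dirDeriv_congr (Filter.eventually_of_mem (hU.mem_nhds hy) (h F G hF hG)),
    dirDeriv_sum i _ fun m _ => ContDiffAt.sum fun K _ => ContDiffAt.sum fun n _ =>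
      ContDiffAt.sum fun L _ => hs m K n L]
  refine Finset.sum_congr rfl fun m _ => ?_
  rw [dirDeriv_sum i _ fun K _ => ContDiffAt.sum fun n _ => ContDiffAt.sum fun L _ => hs m K n L]
  refine Finset.sum_congr rfl fun K _ => ?_
  rw [dirDeriv_sum i _ fun n _ => ContDiffAt.sum fun L _ => hs m K n L]
  refine Finset.sum_congr rfl fun n _ => ?_
  rw [dirDeriv_sum i _ fun L _ => hs m K n L]
  refine Finset.sum_congr rfl fun L _ => ?_
  have hay := (ha m K n L).contDiffAt (hU.mem_nhds hy)
  rw [dirDeriv_mul i (hay.mul (contDiffAt_partialDeriv K hFy)) (contDiffAt_partialDeriv L hGy),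
    dirDeriv_mul i hay (contDiffAt_partialDeriv K hFy), partialDeriv_succ _ hFy,
    partialDeriv_succ _ hGy]
  simp
  ring

theorem partialDeriv_comp (hU : IsOpen U) {m : ℕ} (K : Fin m → Fin d) (hT : LocalBiDO U N T) :
    LocalBiDO U (N + m) (fun F G y => StarProd.partialDeriv K (T F G) y) := by
  induction m with
  | zero => simpa using hT
  | succ m ih =>
    refine ((ih (Fin.tail K)).dirDeriv hU (K 0)).congr fun F G hF hG y hy => ?_
    exact partialDeriv_succ K ((hT.contDiffOn hU hF hG).contDiffAt (hU.mem_nhds hy))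

theorem comp_left (hU : IsOpen U) {S : (Eucl d → ℝ) → Eucl d → ℝ} (hS : LocalDO U N' S)
    (hT : LocalBiDO U N T) : LocalBiDO U (N + N') (fun F G y => S (T F G) y) := by
  obtain ⟨a, ha, h⟩ := hS
  refine congr (T' := fun F G y => ∑ m ∈ Finset.range (N' + 1), ∑ K : Fin m → Fin d,
    a m K y * StarProd.partialDeriv K (T F G) y) ?_
    fun F G hF hG y hy => h (T F G) (hT.contDiffOn hU hF hG) y hy
  refine sum _ fun m hm => sum _ fun K _ =>
    smul (ha m K) ((hT.partialDeriv_comp hU K).mono hU ?_)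
  simp at hm; omega

end LocalBiDO

end LocalOperators

/-! ### Smooth dependence of integrals on parameters and Hadamard's lemma. -/

section Hadamard

theorem hasFDerivAt_intervalIntegral_of_contDiff {E F : Type} [NormedAddCommGroup E]
    [NormedSpace ℝ E] [FiniteDimensional ℝ E] [NormedAddCommGroup F] [NormedSpace ℝ F]
    [CompleteSpace F]
    {f : E → ℝ → F} (hf : ContDiff ℝ 1 (fun p : E × ℝ => f p.1 p.2)) (x₀ : E) :
    HasFDerivAt (fun x => ∫ t in (0 : ℝ)..1, f x t)
      (∫ t in (0 : ℝ)..1, fderiv ℝ (fun x => f x t) x₀) x₀ := by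
  have hpart : ∀ x t, HasFDerivAt (fun x => f x t)
      ((fderiv ℝ (fun p : E × ℝ => f p.1 p.2) (x, t)).comp (ContinuousLinearMap.inl ℝ E ℝ)) x := by
    intro x t
    have h1 := (hf.differentiable (by simp) (x, t)).hasFDerivAt
    exact HasFDerivAt.comp (g := fun p : E × ℝ => f p.1 p.2) (f := fun e => (e, t)) x h1
      (hasFDerivAt_prodMk_left x t)
  have hcont : Continuous fun p : E × ℝ => fderiv ℝ (fun x => f x p.2) p.1 := by
    have : (fun p : E × ℝ => fderiv ℝ (fun x => f x p.2) p.1) = fun p : E × ℝ =>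
        (fderiv ℝ (fun p : E × ℝ => f p.1 p.2) p).comp (ContinuousLinearMap.inl ℝ E ℝ) :=
      funext fun p => (hpart p.1 p.2).fderiv
    rw [this]
    exact (hf.continuous_fderiv (by simp)).clm_comp continuous_const
  -- Compactness of the ball times `[0, 1]` gives a constant dominating the derivative near `x₀`.
  obtain ⟨C, hC⟩ := ((isCompact_closedBall x₀ 1).prod
    (isCompact_Icc (a := (0 : ℝ)) (b := 1))).exists_bound_of_continuousOn hcont.continuousOn
  refine intervalIntegral.hasFDerivAt_integral_of_dominated_of_fderiv_le
    (F' := fun x t => fderiv ℝ (fun x => f x t) x) (bound := fun _ => C)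
    (Metric.closedBall_mem_nhds x₀ one_pos) (Eventually.of_forall fun x => ?_) ?_ ?_ ?_ ?_ ?_
  · exact (hf.continuous.comp (Continuous.prodMk_right x)).aestronglyMeasurable
  · exact (hf.continuous.comp (Continuous.prodMk_right x₀)).intervalIntegrable _ _
  · exact (hcont.comp (Continuous.prodMk_right x₀)).aestronglyMeasurable
  · refine Eventually.of_forall fun t ht x hx => hC (x, t) ⟨hx, ?_⟩
    rw [Set.uIoc_of_le zero_le_one] at ht
    exact Set.Ioc_subset_Icc_self ht
  · exact intervalIntegrable_const
  · exact Eventually.of_forall fun t _ x _ => (hpart x t).differentiableAt.hasFDerivAt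

/-- Induction on `n` by differentiating under the integral. The target space varies in the induction
because the derivative takes values in `E →L[ℝ] F`. -/
theorem contDiff_intervalIntegral {E : Type} [NormedAddCommGroup E] [NormedSpace ℝ E]
    [FiniteDimensional ℝ E] (n : ℕ) : ∀ {F : Type} [NormedAddCommGroup F] [NormedSpace ℝ F]
    [CompleteSpace F]
    {f : E → ℝ → F}, ContDiff ℝ ∞ (fun p : E × ℝ => f p.1 p.2) →
    ContDiff ℝ n (fun x => ∫ t in (0 : ℝ)..1, f x t) := by
  induction n with
  | zero =>
    intro F _ _ _ f hf
    refine contDiff_zero.2 (Differentiable.continuous (𝕜 := ℝ) fun x =>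
      (hasFDerivAt_intervalIntegral_of_contDiff
        (hf.of_le (by exact_mod_cast le_top)) x).differentiableAt)
  | succ n ih =>
    intro F _ _ _ f hf
    have hd := hasFDerivAt_intervalIntegral_of_contDiff (hf.of_le (by exact_mod_cast le_top))
    refine (contDiff_succ_iff_fderiv (n := n)).2 ⟨fun x => (hd x).differentiableAt, by simp, ?_⟩
    rw [funext fun x => (hd x).fderiv]
    apply ih
    have h2 : ContDiff ℝ ∞ (Function.uncurry fun (p : E × ℝ) (x : E) => f x p.2) :=
      hf.comp (contDiff_snd.prodMk (contDiff_snd.comp contDiff_fst))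
    exact ContDiff.fderiv (m := ∞) (n := ∞) h2 contDiff_fst (by simp)

/-- Hadamard's lemma. -/
theorem exists_eq_add_sum_coord_mul {d : ℕ} {G : Eucl d → ℝ} (hG : ContDiff ℝ ∞ G) (y : Eucl d) :
    ∃ g : Fin d → Eucl d → ℝ, (∀ l, ContDiff ℝ ∞ (g l)) ∧
      ∀ z, G z = G y + ∑ l, (z l - y l) * g l z := by
  have hseg : ContDiff ℝ ∞ fun p : Eucl d × ℝ => y + p.2 • (p.1 - y) :=
    contDiff_const.add (contDiff_snd.smul (contDiff_fst.sub contDiff_const))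
  have hf : ∀ l : Fin d, ContDiff ℝ ∞ fun p : Eucl d × ℝ =>
      fderiv ℝ G (y + p.2 • (p.1 - y)) (EuclideanSpace.single l (1 : ℝ)) := fun l =>
    ((hG.fderiv_right (m := ∞) (by simp)).comp hseg).clm_apply contDiff_const
  refine ⟨fun l z => ∫ t in (0 : ℝ)..1,
    fderiv ℝ G (y + t • (z - y)) (EuclideanSpace.single l (1 : ℝ)),
    fun l => contDiff_infty.2 fun n => contDiff_intervalIntegral n (hf l), fun z => ?_⟩
  have hderiv : ∀ t : ℝ, HasDerivAt (fun t : ℝ => G (y + t • (z - y)))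
      (fderiv ℝ G (y + t • (z - y)) (z - y)) t := by
    intro t
    have h1 : HasDerivAt (fun t : ℝ => y + t • (z - y)) (z - y) t := by
      simpa using ((hasDerivAt_id t).smul_const (z - y)).const_add y
    exact ((hG.differentiable (by simp)) _).hasFDerivAt.comp_hasDerivAt t h1
  have hsum : ∀ t : ℝ, fderiv ℝ G (y + t • (z - y)) (z - y) = ∑ l, (z l - y l) *
      fderiv ℝ G (y + t • (z - y)) (EuclideanSpace.single l (1 : ℝ)) := by
    intro t
    have hzy : z - y = ∑ l, (z l - y l) • EuclideanSpace.single l (1 : ℝ) := by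
      have := (EuclideanSpace.basisFun (Fin d) ℝ).sum_repr (z - y)
      simpa using this.symm
    simpa using congrArg (fderiv ℝ G (y + t • (z - y))) hzy
  have hcont : ∀ l : Fin d, Continuous (fun t : ℝ => (z l - y l) *
      fderiv ℝ G (y + t • (z - y)) (EuclideanSpace.single l (1 : ℝ))) := fun l =>
    continuous_const.mul ((hf l).continuous.comp (Continuous.prodMk_right z))
  have hftc := intervalIntegral.integral_eq_sub_of_hasDerivAt (a := 0) (b := 1)
    (fun t _ => hderiv t) (by
      simp only [hsum]
      exact (continuous_finsetSum _ fun l _ => hcont l).intervalIntegrable _ _)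
  simp only [hsum] at hftc
  rw [intervalIntegral.integral_finsetSum fun l _ => (hcont l).intervalIntegrable _ _] at hftc
  simp only [intervalIntegral.integral_const_mul] at hftc
  rw [hftc]
  simp

end Hadamard

/-! ### The algebraic Poincaré lemma for symmetric cocycles at a point. -/

section SymmetricCocycle

/-- A symmetric Hochschild 2-cocycle at a point is a coboundary, provided its contractions with the
coordinates are sums of operators of homogeneous degree for the Euler field. -/
theorem symmetric_cocycle_eq_coboundary {d N : ℕ} {A : Type*} [CommRing A] [Algebra ℝ A]
    (ev : A →ₐ[ℝ] ℝ) (x : Fin d → A) (δ : Fin d → Derivation ℝ A A)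
    (hx : ∀ l, ev (x l) = 0) (hδ : ∀ k l, δ k (x l) = if k = l then 1 else 0)
    (hadamard : ∀ G : A, ∃ g : Fin d → A, G = algebraMap ℝ A (ev G) + ∑ l, x l * g l)
    (b : A →ₗ[ℝ] A →ₗ[ℝ] ℝ) (hsymm : ∀ F G, b F G = b G F) (hone : ∀ G, b 1 G = 0)
    (hcocycle : ∀ F G H, ev F * b G H - b (F * G) H + b F (G * H) - b F G * ev H = 0)
    (C : ℕ → Fin d → A →ₗ[ℝ] ℝ)
    (hC : ∀ F l, b F (x l) = ∑ m ∈ Finset.range (N + 1), C m l F)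
    (heuler : ∀ m l F, C m l (∑ k, x k * δ k F) = m * C m l F)
    (D : A →ₗ[ℝ] ℝ)
    (hD : ∀ F, D F = ∑ m ∈ Finset.range (N + 1), 1 / ((m : ℝ) + 1) * ∑ l, C m l (δ l F))
    (F G : A) : D (F * G) = D F * ev G + ev F * D G + b F G := by
  have hEx : ∀ k F, ∑ j, x j * δ j (x k * F) = x k * F + x k * ∑ j, x j * δ j F := by
    intro k F
    simp only [Derivation.leibniz, hδ, smul_eq_mul, mul_add, Finset.sum_add_distrib,
      Finset.mul_sum]
    rw [add_comm]
    congr 1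
    · simp
    · exact Finset.sum_congr rfl fun j _ => by ring
  -- Closedness of the 1-form of contractions: in the cocycle identities for `(F, x k, x l)` and
  -- `(F, x l, x k)` all other terms agree by symmetry or vanish since `ev (x l) = 0`.
  have hclosed : ∀ k l F, b (x k * F) (x l) = b (x l * F) (x k) := by
    intro k l F
    have h1 := hcocycle F (x k) (x l)
    have h2 := hcocycle F (x l) (x k)
    rw [hx, mul_comm F, mul_comm (x k) (x l)] at h1
    rw [hx, mul_comm F] at h2
    rw [hsymm (x l) (x k)] at h2
    linarith
  -- Closedness has to be split by degree, because the homotopy weights each degree differently.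
  -- Multiplying by `x k` lowers the Euler eigenvalue from `m` to `m - 1`; feeding in iterates of
  -- the Euler field gives all the power moments in `m - 1`, and these numbers are distinct, so
  -- Vandermonde kills each component.
  have hhom : ∀ m ∈ Finset.range (N + 1), ∀ k l F, C m l (x k * F) = C m k (x l * F) := by
    intro m hm k l F
    have key : ∀ (j : ℕ) (F : A), ∑ m ∈ Finset.range (N + 1),
        (C m l (x k * F) - C m k (x l * F)) * ((m : ℝ) - 1) ^ j = 0 := by
      intro j
      induction j with
      | zero =>
        intro F
        simp only [pow_zero, mul_one, Finset.sum_sub_distrib, ← hC]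
        rw [hclosed, sub_self]
      | succ j ih =>
        intro F
        rw [← ih (∑ i, x i * δ i F)]
        refine Finset.sum_congr rfl fun m _ => ?_
        have h : ∀ k l, C m l (x k * ∑ i, x i * δ i F) = ((m : ℝ) - 1) * C m l (x k * F) := by
          intro k l
          have := heuler m l (x k * F)
          rw [hEx, map_add] at this
          linarith
        rw [h, h]
        ring
    have hv := Matrix.eq_zero_of_forall_pow_sum_mul_pow_eq_zero
      (f := fun i : Fin (N + 1) => ((i : ℕ) : ℝ) - 1)
      (v := fun i : Fin (N + 1) => C i l (x k * F) - C i k (x l * F))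
      (fun i j h => by simpa [Fin.ext_iff] using h) (fun i => by
        rw [← key i F, Finset.sum_range])
    have := congrFun hv ⟨m, by simpa using hm⟩
    simpa [sub_eq_zero] using this
  -- The homotopy formula inverts contraction: in degree `m`, closedness turns the sum over `k` into
  -- the Euler operator, contributing `m`, and the diagonal term contributes `1`, cancelling the
  -- weight `1 / (m + 1)`.
  have hDx : ∀ l F, D (x l * F) = b F (x l) := by
    intro l F
    rw [hD, hC]
    refine Finset.sum_congr rfl fun m hm => ?_
    have h1 : ∀ k, C m k (δ k (x l * F)) = C m l (x k * δ k F) + if k = l then C m l F else 0 := by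
      intro k
      rw [Derivation.leibniz, hδ, map_add, smul_eq_mul, smul_eq_mul, hhom m hm l k]
      split_ifs with h
      · simp [h]
      · simp
    simp only [h1, Finset.sum_add_distrib, ← map_sum, heuler]
    have : (m : ℝ) + 1 ≠ 0 := by positivity
    simp
    field_simp
  have hD1 : D 1 = 0 := by simp [hD]
  have hDx1 : ∀ l, D (x l) = 0 := fun l => by
    have := hDx l 1
    rwa [mul_one, hone] at this
  -- For a second argument divisible by `x l`, the values of `D` are contractions of `b`, and the
  -- claim becomes the cocycle identity for `(F, g, x l)`.
  have hstep : ∀ l g, D (F * (x l * g)) = D F * ev (x l * g) + ev F * D (x l * g) +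
      b F (x l * g) := by
    intro l g
    have h1 := hcocycle F g (x l)
    have h2 : F * (x l * g) = x l * (F * g) := by ring
    rw [h2, hDx, hDx, map_mul ev, hx, mul_comm (x l) g]
    rw [hx] at h1
    linarith
  obtain ⟨g, hg⟩ := hadamard G
  have hlin : ∀ c : ℝ, algebraMap ℝ A c = c • 1 := fun c => Algebra.algebraMap_eq_smul_one c
  have hb1 : b F 1 = 0 := (hsymm F 1).trans (hone F)
  set c := ev G
  rw [hg]
  rw [mul_add, map_add D, map_add D, map_add (b F), Finset.mul_sum, map_sum D, map_sum D,
    map_sum (b F), Finset.sum_congr rfl fun l _ => hstep l (g l)]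
  rw [hlin]
  simp [hx, hD1, hb1, Finset.sum_add_distrib, Finset.mul_sum]
  ring

end SymmetricCocycle

theorem Smooth.sum_apply {d : ℕ} {M : Type*} [TopologicalSpace M] [ChartedSpace (Eucl d) M]
    {ι : Type*} (s : Finset ι) (f : ι → Smooth d M) (z : M) :
    (∑ i ∈ s, f i : Smooth d M) z = ∑ i ∈ s, f i z := by
  classical
  induction s using Finset.induction_on with
  | empty => rfl
  | insert i s hi ih =>
    rw [Finset.sum_insert hi, Finset.sum_insert hi, ContMDiffMap.coe_add, Pi.add_apply, ih]

/-! ### The explicit primitive on `ℝ^d`. -/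

section PointwiseOperators

variable {d : ℕ}

theorem dirDeriv_comm (i k : Fin d) {F : Eucl d → ℝ} {y : Eucl d} (hF : ContDiffAt ℝ ∞ F y) :
    dirDeriv i (dirDeriv k F) y = dirDeriv k (dirDeriv i F) y := by
  have h : ∀ i k : Fin d, dirDeriv i (dirDeriv k F) y =
      fderiv ℝ (fderiv ℝ F) y (EuclideanSpace.single i 1) (EuclideanSpace.single k 1) := by
    intro i k
    have hd : DifferentiableAt ℝ (fderiv ℝ F) y :=
      (hF.fderiv_right (m := ∞) (by simp)).differentiableAt (by simp)
    change fderiv ℝ (fun z => fderiv ℝ F z (EuclideanSpace.single k 1)) y _ = _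
    rw [fderiv_clm_apply hd (differentiableAt_const _)]
    simp
  rw [h, h]
  exact (hF.isSymmSndFDerivAt (by simp; exact WithTop.coe_le_coe.2 (le_top : (2 : ℕ∞) ≤ ⊤))) _ _

theorem dirDeriv_coord_sub (i k : Fin d) (c : ℝ) (y : Eucl d) :
    dirDeriv i (fun z : Eucl d => z k - c) y = if i = k then 1 else 0 := by
  unfold dirDeriv
  rw [fderiv_sub_const]
  change fderiv ℝ (EuclideanSpace.proj k : Eucl d →L[ℝ] ℝ) y _ = _
  rw [ContinuousLinearMap.fderiv]
  simp [eq_comm]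

theorem contDiff_coord (k : Fin d) : ContDiff ℝ ∞ fun z : Eucl d => z k :=
  (EuclideanSpace.proj k : Eucl d →L[ℝ] ℝ).contDiff

theorem contDiff_dirDeriv (i : Fin d) {F : Eucl d → ℝ} (hF : ContDiff ℝ ∞ F) :
    ContDiff ℝ ∞ (dirDeriv i F) :=
  contDiff_iff_contDiffAt.2 fun _ => contDiffAt_dirDeriv i hF.contDiffAt

theorem contDiff_partialDeriv {m : ℕ} (K : Fin m → Fin d) {F : Eucl d → ℝ} (hF : ContDiff ℝ ∞ F) :
    ContDiff ℝ ∞ (partialDeriv K F) :=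
  contDiff_iff_contDiffAt.2 fun _ => contDiffAt_partialDeriv K hF.contDiffAt

/-- The commutator of a partial derivative of order `m` with the Euler field centred at `y` is `m`
times that derivative. At `z = y` the remaining sum vanishes, which makes jet coordinates at `y`
eigenvectors of eigenvalue `m`. -/
theorem partialDeriv_euler {m : ℕ} (K : Fin m → Fin d) {F : Eucl d → ℝ} (hF : ContDiff ℝ ∞ F)
    (y z : Eucl d) :
    partialDeriv K (fun z => ∑ k, (z k - y k) * dirDeriv k F z) z =
      m * partialDeriv K F z + ∑ k, (z k - y k) * dirDeriv k (partialDeriv K F) z := by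
  have hx : ∀ k, ContDiff ℝ ∞ fun z : Eucl d => z k - y k := fun k =>
    (contDiff_coord k).sub contDiff_const
  induction m generalizing z with
  | zero =>
    have : partialDeriv K F = F := funext fun z => by simp
    simp [this]
  | succ m ih =>
    have hG := contDiff_partialDeriv (Fin.tail K) hF
    have hE : ContDiff ℝ ∞ fun z => ∑ k, (z k - y k) * dirDeriv k F z :=
      ContDiff.sum fun k _ => (hx k).mul (contDiff_dirDeriv k hF)
    have hK : partialDeriv K F = dirDeriv (K 0) (partialDeriv (Fin.tail K) F) :=
      funext fun z => partialDeriv_succ K hF.contDiffAt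
    rw [partialDeriv_succ K hE.contDiffAt, funext (ih (Fin.tail K)), hK]
    have hs : ∀ k, ContDiff ℝ ∞ fun z => (z k - y k) * dirDeriv k (partialDeriv (Fin.tail K) F) z :=
      fun k => (hx k).mul (contDiff_dirDeriv k hG)
    rw [dirDeriv_add _ (contDiffAt_const.mul hG.contDiffAt)
        (ContDiffAt.sum fun k _ => (hs k).contDiffAt),
      dirDeriv_mul _ contDiffAt_const hG.contDiffAt, dirDeriv_const,
      dirDeriv_sum _ _ fun k _ => (hs k).contDiffAt]
    have : ∀ k, dirDeriv (K 0)
        (fun z => (z k - y k) * dirDeriv k (partialDeriv (Fin.tail K) F) z) z =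
        (if K 0 = k then dirDeriv k (partialDeriv (Fin.tail K) F) z else 0) +
          (z k - y k) * dirDeriv k (dirDeriv (K 0) (partialDeriv (Fin.tail K) F)) z := by
      intro k
      rw [dirDeriv_mul _ (hx k).contDiffAt (contDiff_dirDeriv k hG).contDiffAt,
        dirDeriv_coord_sub, dirDeriv_comm _ _ hG.contDiffAt]
      simp
    simp only [this, Finset.sum_add_distrib]
    simp
    ring

/-- The jet coordinate `F ↦ ∂_K F(y)`. -/
def jetCoord {m : ℕ} (K : Fin m → Fin d) (y : Eucl d) : Smooth d (Eucl d) →ₗ[ℝ] ℝ where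
  toFun F := partialDeriv K F y
  map_add' F G := partialDeriv_add K F.contMDiff.contDiff.contDiffAt G.contMDiff.contDiff.contDiffAt
  map_smul' c F := partialDeriv_const_mul K c F.contMDiff.contDiff.contDiffAt

theorem jetCoord_apply {m : ℕ} (K : Fin m → Fin d) (y : Eucl d) (F : Smooth d (Eucl d)) :
    jetCoord K y F = partialDeriv K F y := rfl

/-- The partial derivative as a derivation of `C^∞(ℝ^d)`. -/
def dirDerivation (i : Fin d) : Derivation ℝ (Smooth d (Eucl d)) (Smooth d (Eucl d)) :=
  Derivation.mk'
    { toFun := fun F => ⟨dirDeriv i F, (contDiff_dirDeriv i F.contMDiff.contDiff).contMDiff⟩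
      map_add' := fun F G => by
        ext z
        exact dirDeriv_add i F.contMDiff.contDiff.contDiffAt G.contMDiff.contDiff.contDiffAt
      map_smul' := fun c F => by
        ext z
        have := dirDeriv_mul i (contDiffAt_const (c := c)) F.contMDiff.contDiff.contDiffAt (y := z)
        rw [dirDeriv_const, zero_mul, zero_add] at this
        exact this }
    (fun F G => by
      ext z
      have := dirDeriv_mul i F.contMDiff.contDiff.contDiffAt G.contMDiff.contDiff.contDiffAt
        (y := z)
      change dirDeriv i (fun z => F z * G z) z = F z * dirDeriv i G z + G z * dirDeriv i F z
      rw [this]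
      ring)

theorem dirDerivation_apply (i : Fin d) (F : Smooth d (Eucl d)) (z : Eucl d) :
    dirDerivation i F z = dirDeriv i F z := rfl

/-- The coefficient at `∂_K` of the contraction of a bidifferential operator with the `l`-th
coordinate. -/
def contractedCoeff (N : ℕ)
    (β : (m : ℕ) → (Fin m → Fin d) → (n : ℕ) → (Fin n → Fin d) → Eucl d → ℝ)
    (l : Fin d) (m : ℕ) (K : Fin m → Fin d) (y : Eucl d) : ℝ :=
  ∑ n ∈ Finset.range (N + 1), ∑ L : Fin n → Fin d, β m K n L y * partialDeriv L (fun z => z l) y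

/-- The differential operator whose Hochschild coboundary is the symmetric cocycle with
coefficients `β`. -/
def cocyclePrimitive (N : ℕ)
    (β : (m : ℕ) → (Fin m → Fin d) → (n : ℕ) → (Fin n → Fin d) → Eucl d → ℝ)
    (F : Eucl d → ℝ) (y : Eucl d) : ℝ :=
  ∑ m ∈ Finset.range (N + 1), 1 / ((m : ℝ) + 1) * ∑ l, ∑ K : Fin m → Fin d,
    contractedCoeff N β l m K y * partialDeriv K (dirDeriv l F) y

theorem localDO_cocyclePrimitive {N : ℕ} {U : Set (Eucl d)} (hU : IsOpen U)
    {β : (m : ℕ) → (Fin m → Fin d) → (n : ℕ) → (Fin n → Fin d) → Eucl d → ℝ}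
    (hβ : ∀ m K n L, ContDiffOn ℝ ∞ (β m K n L) U) :
    LocalDO U (N + 1) (cocyclePrimitive N β) := by
  refine LocalDO.sum _ fun m hm => LocalDO.smul contDiffOn_const <| LocalDO.sum _ fun l _ =>
    LocalDO.sum _ fun K _ => LocalDO.smul ?_
      ((((LocalDO.id (N := 0)).dirDeriv hU l).partialDeriv_comp hU K).mono ?_)
  · exact ContDiffOn.sum fun n _ => ContDiffOn.sum fun L _ =>
      (hβ m K n L).mul (contDiffOn_partialDeriv L hU (contDiff_coord l).contDiffOn)
  · simp at hm; omega

/-- The value at `y` of a bidifferential operator with coefficients `β`, on `C^∞(ℝ^d)`. -/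
def bidiffAt (N : ℕ)
    (β : (m : ℕ) → (Fin m → Fin d) → (n : ℕ) → (Fin n → Fin d) → Eucl d → ℝ) (y : Eucl d) :
    Smooth d (Eucl d) →ₗ[ℝ] Smooth d (Eucl d) →ₗ[ℝ] ℝ :=
  ∑ m ∈ Finset.range (N + 1), ∑ K : Fin m → Fin d,
    ∑ n ∈ Finset.range (N + 1), ∑ L : Fin n → Fin d,
      β m K n L y • (LinearMap.mul ℝ ℝ).compl₁₂ (jetCoord K y) (jetCoord L y)

theorem bidiffAt_apply (N : ℕ)
    (β : (m : ℕ) → (Fin m → Fin d) → (n : ℕ) → (Fin n → Fin d) → Eucl d → ℝ) (y : Eucl d)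
    (F G : Smooth d (Eucl d)) : bidiffAt N β y F G =
      ∑ m ∈ Finset.range (N + 1), ∑ K : Fin m → Fin d,
        ∑ n ∈ Finset.range (N + 1), ∑ L : Fin n → Fin d,
          β m K n L y * partialDeriv K F y * partialDeriv L G y := by
  simp [bidiffAt, LinearMap.sum_apply, jetCoord_apply, mul_assoc]

theorem cocyclePrimitive_mul (N : ℕ)
    (β : (m : ℕ) → (Fin m → Fin d) → (n : ℕ) → (Fin n → Fin d) → Eucl d → ℝ) (y : Eucl d)
    (hsymm : ∀ F G, bidiffAt N β y F G = bidiffAt N β y G F)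
    (hone : ∀ G, bidiffAt N β y 1 G = 0)
    (hcocycle : ∀ F G H : Smooth d (Eucl d), F y * bidiffAt N β y G H - bidiffAt N β y (F * G) H +
      bidiffAt N β y F (G * H) - bidiffAt N β y F G * H y = 0)
    (F G : Smooth d (Eucl d)) :
    cocyclePrimitive N β (F * G : Smooth d (Eucl d)) y =
      cocyclePrimitive N β F y * G y + F y * cocyclePrimitive N β G y + bidiffAt N β y F G := by
  let ev : Smooth d (Eucl d) →ₐ[ℝ] ℝ :=
    { toFun := fun F => F y
      map_one' := rfl
      map_mul' := fun _ _ => rfl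
      map_zero' := rfl
      map_add' := fun _ _ => rfl
      commutes' := fun _ => rfl }
  -- The coefficients of the primitive use the uncentred coordinates `X`, so that they depend
  -- smoothly on `y`; the algebra needs the centred `x`. The two have equal contractions because `b`
  -- kills constants.
  let X : Fin d → Smooth d (Eucl d) := fun l =>
    ⟨fun z => z l, (contDiff_coord l).contMDiff⟩
  let x : Fin d → Smooth d (Eucl d) := fun l =>
    ⟨fun z => z l - y l, ((contDiff_coord l).sub contDiff_const).contMDiff⟩
  let C : ℕ → Fin d → Smooth d (Eucl d) →ₗ[ℝ] ℝ := fun m l =>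
    ∑ K : Fin m → Fin d, contractedCoeff N β l m K y • jetCoord K y
  have hC_apply : ∀ m l F, C m l F = ∑ K : Fin m → Fin d,
      contractedCoeff N β l m K y * partialDeriv K F y := fun m l F => by
    simp [C, LinearMap.sum_apply, jetCoord_apply]
  let D : Smooth d (Eucl d) →ₗ[ℝ] ℝ := ∑ m ∈ Finset.range (N + 1), (1 / ((m : ℝ) + 1)) •
    ∑ l, C m l ∘ₗ (dirDerivation l).toLinearMap
  have hD : ∀ F, D F = ∑ m ∈ Finset.range (N + 1),
      1 / ((m : ℝ) + 1) * ∑ l, C m l (dirDerivation l F) := fun F => by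
    simp [D, LinearMap.sum_apply]
  have hDc : ∀ F : Smooth d (Eucl d), cocyclePrimitive N β F y = D F := fun F => by
    rw [hD]
    simp only [hC_apply]
    rfl
  have hxX : ∀ l, x l = X l - algebraMap ℝ _ (y l) := fun l => by
    ext z
    rfl
  rw [hDc, hDc, hDc]
  refine symmetric_cocycle_eq_coboundary (N := N) ev x dirDerivation
    (fun l => sub_self (y l)) ?_ ?_ (bidiffAt N β y) hsymm hone hcocycle C ?_ ?_ D hD F G
  · intro k l
    ext z
    rw [dirDerivation_apply]
    refine (dirDeriv_coord_sub k l (y l) z).trans ?_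
    split_ifs <;> rfl
  · intro G
    obtain ⟨g, hg, h⟩ := exists_eq_add_sum_coord_mul G.contMDiff.contDiff y
    refine ⟨fun l => ⟨g l, (hg l).contMDiff⟩, ?_⟩
    ext z
    rw [ContMDiffMap.coe_add, Pi.add_apply, h z]
    congr 1
    rw [Smooth.sum_apply]
    rfl
  · intro F l
    have h1 : bidiffAt N β y F (algebraMap ℝ _ (y l)) = 0 := by
      rw [Algebra.algebraMap_eq_smul_one, map_smul, hsymm, hone, smul_zero]
    rw [hxX, map_sub, h1, sub_zero, bidiffAt_apply]
    simp only [hC_apply, contractedCoeff, Finset.sum_mul]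
    refine Finset.sum_congr rfl fun m _ => Finset.sum_congr rfl fun K _ =>
      Finset.sum_congr rfl fun n _ => Finset.sum_congr rfl fun L _ => ?_
    change _ * partialDeriv L (fun z : Eucl d => z l) y = _
    ring
  · intro m l F
    rw [hC_apply, hC_apply, Finset.mul_sum]
    refine Finset.sum_congr rfl fun K _ => ?_
    have hfun : ⇑(∑ k, x k * dirDerivation k F : Smooth d (Eucl d)) =
        fun z => ∑ k, (z k - y k) * dirDeriv k F z := by
      funext z
      rw [Smooth.sum_apply]
      rfl
    rw [hfun, partialDeriv_euler K F.contMDiff.contDiff y y]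
    simp
    ring

end PointwiseOperators

/-! ### Closure properties of differential and bidifferential operators on `M`. -/

section ManifoldOperators

variable {d : ℕ} {M : Type*} [TopologicalSpace M] [ChartedSpace (Eucl d) M]

/-- Hiding the coefficients in a local operator `T` lets closure properties be inherited from open
subsets of `ℝ^d`. The bound `N` stays outside the quantifier over charts. -/
theorem isDifferentialOperator_iff {P : Smooth d M → Smooth d M} :
    IsDifferentialOperator P ↔
      ∃ N : ℕ, ∀ φ ∈ IsManifold.maximalAtlas 𝓘(ℝ, Eucl d) ∞ M, ∃ T, LocalDO φ.target N T ∧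
        ∀ f : Smooth d M, ∀ y ∈ φ.target, P f (φ.symm y) = T (fun z => f (φ.symm z)) y := by
  constructor
  · rintro ⟨N, h⟩
    refine ⟨N, fun φ hφ => ?_⟩
    obtain ⟨a, ha, h'⟩ := h φ hφ
    exact ⟨fun F y => _, ⟨a, ha, fun F _ y _ => rfl⟩, h'⟩
  · rintro ⟨N, h⟩
    refine ⟨N, fun φ hφ => ?_⟩
    obtain ⟨T, ⟨a, ha, hT⟩, h'⟩ := h φ hφ
    exact ⟨a, ha, fun f y hy => (h' f y hy).trans (hT _ (f.contMDiff.comp_contMDiffOn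
      (contMDiffOn_symm_of_mem_maximalAtlas hφ)).contDiffOn y hy)⟩

theorem isBidifferentialOperator_iff {B : Smooth d M → Smooth d M → Smooth d M} :
    IsBidifferentialOperator B ↔
      ∃ N : ℕ, ∀ φ ∈ IsManifold.maximalAtlas 𝓘(ℝ, Eucl d) ∞ M, ∃ T, LocalBiDO φ.target N T ∧
        ∀ f g : Smooth d M, ∀ y ∈ φ.target,
          B f g (φ.symm y) = T (fun z => f (φ.symm z)) (fun z => g (φ.symm z)) y := by
  constructor
  · rintro ⟨N, h⟩
    refine ⟨N, fun φ hφ => ?_⟩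
    obtain ⟨a, ha, h'⟩ := h φ hφ
    exact ⟨fun F G y => _, ⟨a, ha, fun F G _ _ y _ => rfl⟩, h'⟩
  · rintro ⟨N, h⟩
    refine ⟨N, fun φ hφ => ?_⟩
    obtain ⟨T, ⟨a, ha, hT⟩, h'⟩ := h φ hφ
    exact ⟨a, ha, fun f g y hy => (h' f g y hy).trans (hT _ _
      (f.contMDiff.comp_contMDiffOn (contMDiffOn_symm_of_mem_maximalAtlas hφ)).contDiffOn
      (g.contMDiff.comp_contMDiffOn (contMDiffOn_symm_of_mem_maximalAtlas hφ)).contDiffOn y hy)⟩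

theorem Smooth.contDiffOn_symm (f : Smooth d M) {φ : OpenPartialHomeomorph M (Eucl d)}
    (hφ : φ ∈ IsManifold.maximalAtlas 𝓘(ℝ, Eucl d) ∞ M) :
    ContDiffOn ℝ ∞ (fun z => f (φ.symm z)) φ.target :=
  (f.contMDiff.comp_contMDiffOn (contMDiffOn_symm_of_mem_maximalAtlas hφ)).contDiffOn

namespace IsDifferentialOperator

variable {P Q : Smooth d M → Smooth d M}

theorem zero : IsDifferentialOperator (fun _ : Smooth d M => 0) :=
  isDifferentialOperator_iff.2 ⟨0, fun _ _ => ⟨_, LocalDO.zero, fun _ _ _ => rfl⟩⟩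

theorem id : IsDifferentialOperator (fun f : Smooth d M => f) :=
  isDifferentialOperator_iff.2 ⟨0, fun _ _ => ⟨_, LocalDO.id, fun _ _ _ => rfl⟩⟩

theorem neg (hP : IsDifferentialOperator P) : IsDifferentialOperator (fun f => -P f) := by
  obtain ⟨N, h⟩ := isDifferentialOperator_iff.1 hP
  refine isDifferentialOperator_iff.2 ⟨N, fun φ hφ => ?_⟩
  obtain ⟨T, hT, h'⟩ := h φ hφ
  refine ⟨_, hT.smul (contDiffOn_const (c := (-1 : ℝ))), fun f y hy => ?_⟩
  change -(P f (φ.symm y)) = _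
  rw [h' f y hy]
  ring

theorem comp (hP : IsDifferentialOperator P) (hQ : IsDifferentialOperator Q) :
    IsDifferentialOperator (fun f => P (Q f)) := by
  obtain ⟨N, hP⟩ := isDifferentialOperator_iff.1 hP
  obtain ⟨N', hQ⟩ := isDifferentialOperator_iff.1 hQ
  refine isDifferentialOperator_iff.2 ⟨N' + N, fun φ hφ => ?_⟩
  obtain ⟨S, hS, hPS⟩ := hP φ hφ
  obtain ⟨T, hT, hQT⟩ := hQ φ hφ
  refine ⟨_, hS.comp φ.open_target hT, fun f y hy => ?_⟩
  rw [hPS _ y hy]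
  -- The chart expression of `Q f` equals `T` of that of `f` only on `φ.target`, so locality of `S`
  -- is needed.
  exact hS.congr_fun ((Q f).contDiffOn_symm hφ)
    (hT.contDiffOn φ.open_target (f.contDiffOn_symm hφ)) hy
    (Filter.eventually_of_mem (φ.open_target.mem_nhds hy) (hQT f))

end IsDifferentialOperator

namespace IsBidifferentialOperator

variable {B B' : Smooth d M → Smooth d M → Smooth d M} {P Q : Smooth d M → Smooth d M}

theorem zero : IsBidifferentialOperator (fun _ _ : Smooth d M => 0) :=
  isBidifferentialOperator_iff.2 ⟨0, fun _ _ => ⟨_, LocalBiDO.zero, fun _ _ _ _ => rfl⟩⟩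

theorem mul : IsBidifferentialOperator (fun f g : Smooth d M => f * g) :=
  isBidifferentialOperator_iff.2 ⟨0, fun _ _ =>
    ⟨_, LocalBiDO.mul LocalDO.id LocalDO.id, fun _ _ _ _ => rfl⟩⟩

theorem add (hB : IsBidifferentialOperator B) (hB' : IsBidifferentialOperator B') :
    IsBidifferentialOperator (fun f g => B f g + B' f g) := by
  obtain ⟨N, h⟩ := isBidifferentialOperator_iff.1 hB
  obtain ⟨N', h'⟩ := isBidifferentialOperator_iff.1 hB'
  refine isBidifferentialOperator_iff.2 ⟨max N N', fun φ hφ => ?_⟩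
  obtain ⟨T, hT, hBT⟩ := h φ hφ
  obtain ⟨T', hT', hBT'⟩ := h' φ hφ
  refine ⟨_, (hT.mono φ.open_target (le_max_left _ _)).add
    (hT'.mono φ.open_target (le_max_right _ _)), fun f g y hy => ?_⟩
  rw [← hBT f g y hy, ← hBT' f g y hy]
  rfl

theorem sum {ι : Type*} (s : Finset ι) {B : ι → Smooth d M → Smooth d M → Smooth d M}
    (h : ∀ i ∈ s, IsBidifferentialOperator (B i)) :
    IsBidifferentialOperator (fun f g => ∑ i ∈ s, B i f g) := by
  classical
  induction s using Finset.induction_on with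
  | empty => simpa using zero
  | insert i s hi ih =>
    simp only [Finset.sum_insert hi]
    exact (h i (Finset.mem_insert_self i s)).add
      (ih fun j hj => h j (Finset.mem_insert_of_mem hj))

theorem const_smul (hB : IsBidifferentialOperator B) (c : ℝ) :
    IsBidifferentialOperator (fun f g => c • B f g) := by
  obtain ⟨N, h⟩ := isBidifferentialOperator_iff.1 hB
  refine isBidifferentialOperator_iff.2 ⟨N, fun φ hφ => ?_⟩
  obtain ⟨T, hT, hBT⟩ := h φ hφ
  refine ⟨_, hT.smul (contDiffOn_const (c := c)), fun f g y hy => ?_⟩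
  rw [← hBT f g y hy]
  rfl

theorem swap (hB : IsBidifferentialOperator B) :
    IsBidifferentialOperator (fun f g => B g f) := by
  obtain ⟨N, h⟩ := isBidifferentialOperator_iff.1 hB
  refine isBidifferentialOperator_iff.2 ⟨N, fun φ hφ => ?_⟩
  obtain ⟨T, hT, hBT⟩ := h φ hφ
  exact ⟨_, hT.swap, fun f g y hy => hBT g f y hy⟩

theorem comp (hB : IsBidifferentialOperator B) (hP : IsDifferentialOperator P)
    (hQ : IsDifferentialOperator Q) : IsBidifferentialOperator (fun f g => B (P f) (Q g)) := by
  obtain ⟨N, h⟩ := isBidifferentialOperator_iff.1 hB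
  obtain ⟨N₁, hP⟩ := isDifferentialOperator_iff.1 hP
  obtain ⟨N₂, hQ⟩ := isDifferentialOperator_iff.1 hQ
  refine isBidifferentialOperator_iff.2 ⟨max N₁ N₂ + N, fun φ hφ => ?_⟩
  obtain ⟨T, hT, hBT⟩ := h φ hφ
  obtain ⟨S₁, hS₁, hP⟩ := hP φ hφ
  obtain ⟨S₂, hS₂, hQ⟩ := hQ φ hφ
  refine ⟨_, hT.comp φ.open_target (hS₁.mono (le_max_left _ _)) (hS₂.mono (le_max_right _ _)),
    fun f g y hy => ?_⟩
  rw [hBT _ _ y hy]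
  exact hT.congr_fun ((P f).contDiffOn_symm hφ)
    (hS₁.contDiffOn φ.open_target (f.contDiffOn_symm hφ)) ((Q g).contDiffOn_symm hφ)
    (hS₂.contDiffOn φ.open_target (g.contDiffOn_symm hφ)) hy
    (Filter.eventually_of_mem (φ.open_target.mem_nhds hy) (hP f))
    (Filter.eventually_of_mem (φ.open_target.mem_nhds hy) (hQ g))

theorem comp_left (hP : IsDifferentialOperator P) (hB : IsBidifferentialOperator B) :
    IsBidifferentialOperator (fun f g => P (B f g)) := by
  obtain ⟨N, h⟩ := isBidifferentialOperator_iff.1 hB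
  obtain ⟨N', hP⟩ := isDifferentialOperator_iff.1 hP
  refine isBidifferentialOperator_iff.2 ⟨N + N', fun φ hφ => ?_⟩
  obtain ⟨T, hT, hBT⟩ := h φ hφ
  obtain ⟨S, hS, hP⟩ := hP φ hφ
  refine ⟨_, hT.comp_left φ.open_target hS, fun f g y hy => ?_⟩
  rw [hP _ y hy]
  exact hS.congr_fun ((B f g).contDiffOn_symm hφ)
    (hT.contDiffOn φ.open_target (f.contDiffOn_symm hφ) (g.contDiffOn_symm hφ)) hy
    (Filter.eventually_of_mem (φ.open_target.mem_nhds hy) (hBT f g))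

end IsBidifferentialOperator

end ManifoldOperators

/-! ### From charts to the manifold: germs, point derivations and partitions of unity. -/

section Gluing

variable {d : ℕ} {M : Type*} [TopologicalSpace M] [ChartedSpace (Eucl d) M]

/-- A function smooth near `p` has the germ at `p` of a global smooth function. -/
theorem exists_smooth_eventuallyEq [T2Space M] [IsManifold 𝓘(ℝ, Eucl d) ∞ M]
    {U : Set M} (hU : IsOpen U) {p : M} (hp : p ∈ U) {h : M → ℝ}
    (hh : ContMDiffOn 𝓘(ℝ, Eucl d) 𝓘(ℝ) ∞ h U) : ∃ f : Smooth d M, ⇑f =ᶠ[𝓝 p] h := by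
  obtain ⟨χ, -, hχ⟩ := (SmoothBumpFunction.nhds_basis_tsupport (I := 𝓘(ℝ, Eucl d)) p).mem_iff.1
    (hU.mem_nhds hp)
  refine ⟨⟨fun x => χ x • h x, contMDiff_of_tsupport fun x hx => ?_⟩, ?_⟩
  · exact χ.contMDiffAt.smul
      (hh.contMDiffAt (hU.mem_nhds (hχ (tsupport_smul_subset_left _ _ hx))))
  · filter_upwards [χ.eventuallyEq_one] with x hx
    change χ x • h x = h x
    rw [hx]
    simp

variable {φ : OpenPartialHomeomorph M (Eucl d)} {y : Eucl d}

theorem exists_smooth_germ_chart [T2Space M] [IsManifold 𝓘(ℝ, Eucl d) ∞ M]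
    (hφ : φ ∈ IsManifold.maximalAtlas 𝓘(ℝ, Eucl d) ∞ M) (hy : y ∈ φ.target)
    {F : Eucl d → ℝ} (hF : ContDiffOn ℝ ∞ F φ.target) :
    ∃ f : Smooth d M, (fun z => f (φ.symm z)) =ᶠ[𝓝 y] F := by
  obtain ⟨f, hf⟩ := exists_smooth_eventuallyEq φ.open_source (φ.map_target hy)
    (h := fun x => F (φ x))
    (hF.contMDiffOn.comp (contMDiffOn_of_mem_maximalAtlas hφ) fun x hx => φ.map_source hx)
  refine ⟨f, ?_⟩
  filter_upwards [(φ.continuousAt_symm hy).eventually hf, φ.open_target.mem_nhds hy] with z hz hz'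
  rw [hz, φ.right_inv hz']

theorem exists_smooth_germ_model
    (hφ : φ ∈ IsManifold.maximalAtlas 𝓘(ℝ, Eucl d) ∞ M) (hy : y ∈ φ.target) (f : Smooth d M) :
    ∃ F : Smooth d (Eucl d), ⇑F =ᶠ[𝓝 y] fun z => f (φ.symm z) :=
  exists_smooth_eventuallyEq φ.open_target hy (f.contDiffOn_symm hφ).contMDiffOn

theorem eventuallyEq_of_germ_chart (hy : y ∈ φ.target) {f g : Smooth d M}
    (h : (fun z => f (φ.symm z)) =ᶠ[𝓝 y] fun z => g (φ.symm z)) :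
    ⇑f =ᶠ[𝓝 (φ.symm y)] g := by
  have hc := φ.continuousAt (φ.map_target hy)
  rw [ContinuousAt, φ.right_inv hy] at hc
  filter_upwards [hc.eventually h, φ.open_source.mem_nhds (φ.map_target hy)] with x hx hx'
  simpa [φ.left_inv hx'] using hx

/-- A derivation at a point is a local operator. -/
theorem pointDerivation_congr [T2Space M] [IsManifold 𝓘(ℝ, Eucl d) ∞ M] {p : M}
    (v : Smooth d M →ₗ[ℝ] ℝ) (hv : ∀ f g : Smooth d M, v (f * g) = v f * g p + f p * v g)
    {f g : Smooth d M} (h : ⇑f =ᶠ[𝓝 p] g) : v f = v g := by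
  obtain ⟨U, hU, hUo, hp⟩ := eventually_nhds_iff.1 h
  obtain ⟨χ, hχs, hχ⟩ := (SmoothBumpFunction.nhds_basis_tsupport (I := 𝓘(ℝ, Eucl d)) p).mem_iff.1
    (hUo.mem_nhds hp)
  let k : Smooth d M := ⟨χ, χ.contMDiff⟩
  -- The cutoff `k` is supported where `f = g`. Leibniz applied to this product isolates `v (f -
  -- g)`, because `k p = 1` and `(f - g) p = 0`.
  have h0 : k * (f - g) = 0 := by
    ext x
    change χ x * (f x - g x) = 0
    by_cases hx : x ∈ tsupport χ
    · rw [hU x (hχ hx), sub_self, mul_zero]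
    · rw [image_eq_zero_of_notMem_tsupport hx, zero_mul]
  have h1 := hv k (f - g)
  have h2 : (f - g) p = 0 := sub_eq_zero.2 (hU p hp)
  have h3 : k p = 1 := χ.eq_one
  rw [h0, map_zero, h2, h3, mul_zero, zero_add, one_mul, map_sub] at h1
  exact (sub_eq_zero.1 h1.symm)

/-- A derivation at a point is a combination of the partial derivatives in a chart. -/
theorem pointDerivation_eq_sum [T2Space M] [IsManifold 𝓘(ℝ, Eucl d) ∞ M]
    (hφ : φ ∈ IsManifold.maximalAtlas 𝓘(ℝ, Eucl d) ∞ M) (hy : y ∈ φ.target)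
    (v : Smooth d M →ₗ[ℝ] ℝ)
    (hv : ∀ f g : Smooth d M, v (f * g) = v f * g (φ.symm y) + f (φ.symm y) * v g)
    {X : Fin d → Smooth d M} (hX : ∀ l, (fun z => X l (φ.symm z)) =ᶠ[𝓝 y] fun z => z l)
    (f : Smooth d M) :
    v f = ∑ l, v (X l) * dirDeriv l (fun z => f (φ.symm z)) y := by
  obtain ⟨F, hF⟩ := exists_smooth_germ_model hφ hy f
  obtain ⟨g, hg, hFg⟩ := exists_eq_add_sum_coord_mul F.contMDiff.contDiff y
  choose G hG using fun l => exists_smooth_germ_chart hφ hy (hg l).contDiffOn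
  have hv1 : v 1 = 0 := by
    have h : v (1 * 1) = v 1 * 1 + 1 * v 1 := hv 1 1
    rw [mul_one] at h
    linarith
  have hXy : ∀ l, X l (φ.symm y) = y l := fun l => (hX l).eq_of_nhds
  have hGy : ∀ l, G l (φ.symm y) = g l y := fun l => (hG l).eq_of_nhds
  -- Hadamard's expansion, transferred to global functions on `M`; it holds only as germs, which is
  -- enough since `v` is local.
  have hf : ⇑f =ᶠ[𝓝 (φ.symm y)] (F y • (1 : Smooth d M) + ∑ l, (X l - y l • 1) * G l :
      Smooth d M) := by
    refine eventuallyEq_of_germ_chart hy ?_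
    have h1 := eventually_all.2 hX
    have h2 := eventually_all.2 hG
    filter_upwards [hF, h1, h2] with z hz hz1 hz2
    rw [← hz, hFg z, ContMDiffMap.coe_add, Pi.add_apply, Smooth.sum_apply]
    congr 1
    · exact (mul_one _).symm
    · refine Finset.sum_congr rfl fun l _ => ?_
      change _ = (X l (φ.symm z) - y l * 1) * G l (φ.symm z)
      rw [hz1, hz2, mul_one]
  have hvl : ∀ l, v ((X l - y l • 1) * G l) = v (X l) * g l y := by
    intro l
    have h0 : (X l - y l • 1 : Smooth d M) (φ.symm y) = 0 := by
      change X l (φ.symm y) - y l * 1 = 0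
      rw [hXy, mul_one, sub_self]
    rw [hv, h0, hGy, map_sub, map_smul, hv1]
    simp
  have hder : ∀ l, dirDeriv l (fun z => f (φ.symm z)) y = g l y := by
    intro l
    have hs : ∀ k, ContDiffAt ℝ ∞ (fun z : Eucl d => z k - y k) y := fun k =>
      ((contDiff_coord k).sub contDiff_const).contDiffAt
    rw [← dirDeriv_congr hF, funext hFg, dirDeriv_add _ contDiffAt_const
      (ContDiffAt.sum fun k _ => (hs k).mul (hg k).contDiffAt), dirDeriv_const,
      dirDeriv_sum _ _ fun k _ => (hs k).mul (hg k).contDiffAt]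
    simp [dirDeriv_mul _ (hs _) (hg _).contDiffAt, dirDeriv_coord_sub]
  rw [pointDerivation_congr v hv hf, map_add, map_smul, hv1, map_sum]
  simp [hvl, hder]

/-- `B` is a normalized symmetric Hochschild 2-cocycle on `C^∞(M)`. -/
structure IsSymmetricCocycle (B : Smooth d M → Smooth d M → Smooth d M) : Prop where
  symm : ∀ f g, B f g = B g f
  one_left : ∀ g, B 1 g = 0
  cocycle : ∀ f g h, f * B g h - B (f * g) h + B f (g * h) - B f g * h = 0

/-- The pointwise result is about functions on all of `ℝ^d`. Cutoffs represent each germ both on `M`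
and on `ℝ^d`, so the cocycle properties of `B` pass to `bidiffAt` at `y` and the conclusion passes
back. -/
theorem cocyclePrimitive_mul_chart [T2Space M] [IsManifold 𝓘(ℝ, Eucl d) ∞ M]
    {B : Smooth d M → Smooth d M → Smooth d M} (hB : IsSymmetricCocycle B)
    (hφ : φ ∈ IsManifold.maximalAtlas 𝓘(ℝ, Eucl d) ∞ M) {N : ℕ}
    {β : (m : ℕ) → (Fin m → Fin d) → (n : ℕ) → (Fin n → Fin d) → Eucl d → ℝ}
    (hβ : ∀ m K n L, ContDiffOn ℝ ∞ (β m K n L) φ.target)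
    (h : ∀ f g : Smooth d M, ∀ y ∈ φ.target, B f g (φ.symm y) =
      ∑ m ∈ Finset.range (N + 1), ∑ K : Fin m → Fin d,
        ∑ n ∈ Finset.range (N + 1), ∑ L : Fin n → Fin d,
          β m K n L y * partialDeriv K (fun z => f (φ.symm z)) y *
            partialDeriv L (fun z => g (φ.symm z)) y)
    (hy : y ∈ φ.target) (f g : Smooth d M) :
    cocyclePrimitive N β (fun z => (f * g) (φ.symm z)) y =
      cocyclePrimitive N β (fun z => f (φ.symm z)) y * g (φ.symm y) +
        f (φ.symm y) * cocyclePrimitive N β (fun z => g (φ.symm z)) y + B f g (φ.symm y) := by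
  have key : ∀ {F G : Smooth d (Eucl d)} {f g : Smooth d M},
      (fun z => f (φ.symm z)) =ᶠ[𝓝 y] F → (fun z => g (φ.symm z)) =ᶠ[𝓝 y] G →
      bidiffAt N β y F G = B f g (φ.symm y) := by
    intro F G f g hF hG
    rw [h f g y hy, bidiffAt_apply]
    simp only [partialDeriv_congr hF, partialDeriv_congr hG]
  have hmul : ∀ {F G : Smooth d (Eucl d)} {f g : Smooth d M},
      (fun z => f (φ.symm z)) =ᶠ[𝓝 y] F → (fun z => g (φ.symm z)) =ᶠ[𝓝 y] G →
      (fun z => (f * g) (φ.symm z)) =ᶠ[𝓝 y] (F * G : Smooth d (Eucl d)) := fun hF hG => hF.mul hG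
  have hone : (fun z => (1 : Smooth d M) (φ.symm z)) =ᶠ[𝓝 y] (1 : Smooth d (Eucl d)) :=
    EventuallyEq.rfl
  have hext : ∀ F : Smooth d (Eucl d), ∃ f : Smooth d M, (fun z => f (φ.symm z)) =ᶠ[𝓝 y] F :=
    fun F => exists_smooth_germ_chart hφ hy F.contMDiff.contDiff.contDiffOn
  obtain ⟨F, hF⟩ := exists_smooth_germ_model hφ hy f
  obtain ⟨G, hG⟩ := exists_smooth_germ_model hφ hy g
  have hP := localDO_cocyclePrimitive (N := N) φ.open_target hβ
  have hcongr : ∀ {F : Smooth d (Eucl d)} {f : Smooth d M},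
      (fun z => f (φ.symm z)) =ᶠ[𝓝 y] F →
      cocyclePrimitive N β (fun z => f (φ.symm z)) y = cocyclePrimitive N β F y :=
    fun {F f} hF => hP.congr_fun (f.contDiffOn_symm hφ) F.contMDiff.contDiff.contDiffOn hy hF
  rw [hcongr (hmul hF.symm hG.symm), hcongr hF.symm, hcongr hG.symm, ← key hF.symm hG.symm,
    ← hF.eq_of_nhds, ← hG.eq_of_nhds]
  refine cocyclePrimitive_mul N β y ?_ ?_ ?_ F G
  · intro F G
    obtain ⟨f, hf⟩ := hext F
    obtain ⟨g, hg⟩ := hext G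
    rw [key hf hg, key hg hf, hB.symm]
  · intro G
    obtain ⟨g, hg⟩ := hext G
    rw [key hone hg, hB.one_left]
    rfl
  · intro F G H
    obtain ⟨f, hf⟩ := hext F
    obtain ⟨g, hg⟩ := hext G
    obtain ⟨h, hh⟩ := hext H
    rw [key hg hh, key (hmul hf hg) hh, key hf (hmul hg hh), key hf hg, ← hf.eq_of_nhds,
      ← hh.eq_of_nhds]
    exact congrArg (fun u : Smooth d M => u (φ.symm y)) (hB.cocycle f g h)

/-- A linear operator whose Hochschild coboundary is a bidifferential symmetric cocycle is a
differential operator. -/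
theorem isDifferentialOperator_of_coboundary [T2Space M] [IsManifold 𝓘(ℝ, Eucl d) ∞ M]
    {B : Smooth d M → Smooth d M → Smooth d M} (hB : IsSymmetricCocycle B)
    (hBd : IsBidifferentialOperator B) (D : Smooth d M →ₗ[ℝ] Smooth d M)
    (hD : ∀ f g, D (f * g) = D f * g + f * D g + B f g) : IsDifferentialOperator D := by
  classical
  obtain ⟨N, hN⟩ := hBd
  refine isDifferentialOperator_iff.2 ⟨N + 1, fun φ hφ => ?_⟩
  obtain ⟨β, hβ, hBβ⟩ := hN φ hφ
  have hP := localDO_cocyclePrimitive (N := N) φ.open_target hβ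
  choose! X hX using fun (y : Eucl d) (hy : y ∈ φ.target) (l : Fin d) =>
    exists_smooth_germ_chart hφ hy (contDiff_coord l).contDiffOn
  -- Both `D` and the explicit primitive of this chart solve the same affine equation, so their
  -- difference `w` is a derivation at each point.
  let w : Smooth d M → Eucl d → ℝ := fun f y =>
    D f (φ.symm y) - cocyclePrimitive N β (fun z => f (φ.symm z)) y
  have hv : ∀ y ∈ φ.target, ∃ v : Smooth d M →ₗ[ℝ] ℝ, (∀ f, v f = w f y) ∧
      ∀ f g : Smooth d M, v (f * g) = v f * g (φ.symm y) + f (φ.symm y) * v g := by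
    intro y hy
    refine ⟨{ toFun := fun f => w f y, map_add' := fun f g => ?_, map_smul' := fun c f => ?_ },
      fun _ => rfl, fun f g => ?_⟩
    · have h := hP.map_add φ.open_target (f.contDiffOn_symm hφ) (g.contDiffOn_symm hφ) hy
      have h' : cocyclePrimitive N β (fun z => (f + g) (φ.symm z)) y = _ := h
      change w (f + g) y = w f y + w g y
      simp only [w]
      rw [h', map_add, ContMDiffMap.coe_add, Pi.add_apply]
      ring
    · have h := hP.map_const_mul φ.open_target c (f.contDiffOn_symm hφ) hy
      have h' : cocyclePrimitive N β (fun z => (c • f) (φ.symm z)) y = _ := h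
      change w (c • f) y = c * w f y
      simp only [w]
      rw [h', map_smul, ContMDiffMap.coe_smul, Pi.smul_apply, smul_eq_mul]
      ring
    · have h := cocyclePrimitive_mul_chart hB hφ hβ hBβ hy f g
      have h' : D (f * g) (φ.symm y) = D f (φ.symm y) * g (φ.symm y) +
          f (φ.symm y) * D g (φ.symm y) + B f g (φ.symm y) := by
        rw [hD]
        rfl
      change w (f * g) y = w f y * _ + _ * w g y
      simp only [w, h, h']
      ring
  -- The extension `X y l` of the coordinate need not vary smoothly with `y`. Near `y₀` it has the
  -- same germ at `y` as the fixed function `X y₀ l`, so locality of derivations allows freezing it.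
  have ha : ∀ l, ContDiffOn ℝ ∞ (fun y => w (X y l) y) φ.target := by
    intro l y₀ hy₀
    have h1 : ContDiffOn ℝ ∞ (w (X y₀ l)) φ.target :=
      ((D (X y₀ l)).contDiffOn_symm hφ).sub
        (hP.contDiffOn φ.open_target ((X y₀ l).contDiffOn_symm hφ))
    refine ((h1.contDiffAt (φ.open_target.mem_nhds hy₀)).congr_of_eventuallyEq
      ?_).contDiffWithinAt
    filter_upwards [φ.open_target.mem_nhds hy₀, (hX y₀ hy₀ l).eventuallyEq_nhds] with y hy hy'
    obtain ⟨v, hvw, hv⟩ := hv y hy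
    rw [← hvw, ← hvw]
    exact pointDerivation_congr v hv (eventuallyEq_of_germ_chart hy ((hX y hy l).trans hy'.symm))
  refine ⟨_, hP.add (LocalDO.sum Finset.univ fun l _ =>
    LocalDO.smul (ha l) ((LocalDO.id (N := 0)).dirDeriv φ.open_target l |>.mono (by omega))),
    fun f y hy => ?_⟩
  obtain ⟨v, hvw, hv⟩ := hv y hy
  have := pointDerivation_eq_sum hφ hy v hv (hX y hy) f
  simp only [hvw] at this
  rw [← this]
  ring

/-- A bidifferential symmetric Hochschild 2-cocycle on `C^∞(M)` is a coboundary. -/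
theorem exists_linear_primitive [T2Space M] [SigmaCompactSpace M] [IsManifold 𝓘(ℝ, Eucl d) ∞ M]
    {B : Smooth d M → Smooth d M → Smooth d M} (hB : IsSymmetricCocycle B)
    (hBd : IsBidifferentialOperator B) :
    ∃ D : Smooth d M →ₗ[ℝ] Smooth d M, ∀ f g, D (f * g) = D f * g + f * D g + B f g := by
  obtain ⟨N, hN⟩ := hBd
  have hch : ∀ i : M, chartAt (Eucl d) i ∈ IsManifold.maximalAtlas 𝓘(ℝ, Eucl d) ∞ M :=
    fun i => IsManifold.chart_mem_maximalAtlas i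
  choose β hβ hBβ using fun i : M => hN _ (hch i)
  obtain ⟨ρ, hρ⟩ := SmoothPartitionOfUnity.exists_isSubordinate_chartAt_source 𝓘(ℝ, Eucl d) M
  have hP := fun i => localDO_cocyclePrimitive (N := N) (chartAt (Eucl d) i).open_target (hβ i)
  let P : Smooth d M → M → M → ℝ := fun f i x =>
    cocyclePrimitive N (β i) (fun z => f ((chartAt (Eucl d) i).symm z)) (chartAt (Eucl d) i x)
  have hsrc : ∀ x, ∀ i ∈ ρ.finsupport x, x ∈ (chartAt (Eucl d) i).source := by
    intro x i hi
    rw [SmoothPartitionOfUnity.mem_finsupport] at hi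
    exact hρ i (subset_tsupport _ hi)
  have hsm : ∀ f, ContMDiff 𝓘(ℝ, Eucl d) 𝓘(ℝ) ∞ fun x => ∑ᶠ i, ρ i x • P f i x := by
    intro f
    refine hρ.contMDiff_finsum_smul (fun i => (chartAt (Eucl d) i).open_source) fun i => ?_
    exact ((hP i).contDiffOn (chartAt (Eucl d) i).open_target
      (f.contDiffOn_symm (hch i))).contMDiffOn.comp
        (contMDiffOn_of_mem_maximalAtlas (hch i)) fun x hx => (chartAt (Eucl d) i).map_source hx
  let D : Smooth d M → Smooth d M := fun f => ⟨_, hsm f⟩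
  have hval : ∀ f x, D f x = ∑ i ∈ ρ.finsupport x, ρ i x * P f i x :=
    fun f x => (ρ.sum_finsupport_smul_eq_finsum x (fun i x => P f i x)).symm
  refine ⟨{ toFun := D, map_add' := fun f g => ?_,
            map_smul' := fun c f => ?_ }, fun f g => ?_⟩
  · ext x
    rw [ContMDiffMap.coe_add, Pi.add_apply, hval, hval, hval, ← Finset.sum_add_distrib]
    refine Finset.sum_congr rfl fun i hi => ?_
    have h : P (f + g) i x = P f i x + P g i x :=
      (hP i).map_add (chartAt (Eucl d) i).open_target (f.contDiffOn_symm (hch i))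
        (g.contDiffOn_symm (hch i)) ((chartAt (Eucl d) i).map_source (hsrc x i hi))
    rw [h, mul_add]
  · ext x
    rw [RingHom.id_apply, ContMDiffMap.coe_smul, Pi.smul_apply, hval, hval, Finset.smul_sum]
    refine Finset.sum_congr rfl fun i hi => ?_
    have h : P (c • f) i x = c * P f i x :=
      (hP i).map_const_mul (chartAt (Eucl d) i).open_target c (f.contDiffOn_symm (hch i))
        ((chartAt (Eucl d) i).map_source (hsrc x i hi))
    rw [h, smul_eq_mul, mul_left_comm]
  · ext x
    change D (f * g) x = D f x * g x + f x * D g x + B f g x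
    -- The weights sum to one, so a weighted mean of solutions of the affine equation is again a
    -- solution.
    have h1 : B f g x = ∑ i ∈ ρ.finsupport x, ρ i x * B f g x := by
      rw [← Finset.sum_mul, ρ.sum_finsupport x (Set.mem_univ x), one_mul]
    rw [hval, hval, hval, h1, Finset.sum_mul, Finset.mul_sum, ← Finset.sum_add_distrib,
      ← Finset.sum_add_distrib]
    refine Finset.sum_congr rfl fun i hi => ?_
    have hx := hsrc x i hi
    have h := cocyclePrimitive_mul_chart hB (hch i) (hβ i) (hBβ i)
      ((chartAt (Eucl d) i).map_source hx) f g
    rw [(chartAt (Eucl d) i).left_inv hx] at h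
    change P (f * g) i x = P f i x * g x + f x * P g i x + B f g x at h
    rw [h]
    ring

end Gluing

/-! ### `ℝ⟦ε⟧`-linear operators and the automorphism `id + ε D`. -/

section PowerSeriesOperators

variable {A : Type*} [CommRing A] [Algebra ℝ A]

theorem X_smul_eq (q : A⟦X⟧) : (PowerSeries.X : ℝ⟦X⟧) • q = PowerSeries.X * q := by
  rw [Algebra.smul_def]
  congr 1
  exact PowerSeries.map_X _

theorem coeff_powerSeries_smul (r : ℝ⟦X⟧) (p : A⟦X⟧) (n : ℕ) :
    PowerSeries.coeff n (r • p) = ∑ ij ∈ antidiagonal n,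
      PowerSeries.coeff ij.1 r • PowerSeries.coeff ij.2 p := by
  rw [Algebra.smul_def, PowerSeries.coeff_mul]
  refine Finset.sum_congr rfl fun ij _ => ?_
  rw [Algebra.smul_def]
  congr 1

/-- The coefficients of an `ℝ⟦ε⟧`-linear operator are determined by its values on constants. -/
theorem coeff_linearMap_apply (T : A⟦X⟧ →ₗ[ℝ⟦X⟧] A⟦X⟧) (p : A⟦X⟧) (n : ℕ) :
    PowerSeries.coeff n (T p) = ∑ ij ∈ antidiagonal n,
      PowerSeries.coeff ij.1 (T (PowerSeries.C (PowerSeries.coeff ij.2 p))) := by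
  have hp : ∀ p : A⟦X⟧, T p =
      PowerSeries.X * T (PowerSeries.mk fun n => PowerSeries.coeff (n + 1) p) +
        T (PowerSeries.C (PowerSeries.coeff 0 p)) := by
    intro p
    rw [← X_smul_eq, ← map_smul, ← map_add, X_smul_eq]
    congr 1
    simpa using PowerSeries.eq_X_mul_shift_add_const p
  induction n generalizing p with
  | zero =>
    rw [hp]
    simp
  | succ n ih =>
    rw [hp, map_add, PowerSeries.coeff_succ_X_mul, ih, Finset.Nat.antidiagonal_succ']
    rw [Finset.sum_cons, add_comm, Finset.sum_map]
    simp

theorem linearMap_ext_C {T T' : A⟦X⟧ →ₗ[ℝ⟦X⟧] A⟦X⟧}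
    (h : ∀ a : A, T (PowerSeries.C a) = T' (PowerSeries.C a)) : T = T' := by
  ext p n
  rw [coeff_linearMap_apply T, coeff_linearMap_apply T']
  simp only [h]

/-- The coefficientwise extension of a linear operator. -/
def coeffwise (D : A →ₗ[ℝ] A) : A⟦X⟧ →ₗ[ℝ⟦X⟧] A⟦X⟧ where
  toFun p := PowerSeries.mk fun n => D (PowerSeries.coeff n p)
  map_add' p q := by ext n; simp
  map_smul' r p := by
    ext n
    simp [coeff_powerSeries_smul]

/-- The operator `id + ε D`. -/
def idAddX (D : A →ₗ[ℝ] A) : A⟦X⟧ →ₗ[ℝ⟦X⟧] A⟦X⟧ :=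
  LinearMap.id + (PowerSeries.X : ℝ⟦X⟧) • coeffwise D

theorem coeff_zero_idAddX (D : A →ₗ[ℝ] A) (p : A⟦X⟧) :
    PowerSeries.coeff 0 (idAddX D p) = PowerSeries.coeff 0 p := by
  simp [idAddX, X_smul_eq]

theorem coeff_succ_idAddX (D : A →ₗ[ℝ] A) (p : A⟦X⟧) (n : ℕ) :
    PowerSeries.coeff (n + 1) (idAddX D p) =
      PowerSeries.coeff (n + 1) p + D (PowerSeries.coeff n p) := by
  simp [idAddX, X_smul_eq, coeffwise, PowerSeries.coeff_succ_X_mul]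

theorem idAddX_bijective (D : A →ₗ[ℝ] A) : Function.Bijective (idAddX D) := by
  constructor
  · rw [← LinearMap.ker_eq_bot, LinearMap.ker_eq_bot']
    intro p hp
    ext n
    induction n with
    | zero => rw [← coeff_zero_idAddX D, hp]
    | succ n ih =>
      have := coeff_succ_idAddX D p n
      rw [hp, ih] at this
      simpa using this.symm
  · intro q
    -- Solves `p + ε D p = q` coefficient by coefficient.
    refine ⟨PowerSeries.mk fun n => Nat.rec (PowerSeries.coeff 0 q)
      (fun n a => PowerSeries.coeff (n + 1) q - D a) n, ?_⟩
    ext n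
    cases n with
    | zero => simp [coeff_zero_idAddX]
    | succ n => simp [coeff_succ_idAddX]

/-- The automorphism `id + ε D`. -/
def idAddXEquiv (D : A →ₗ[ℝ] A) : A⟦X⟧ ≃ₗ[ℝ⟦X⟧] A⟦X⟧ :=
  LinearEquiv.ofBijective (idAddX D) (idAddX_bijective D)

theorem idAddXEquiv_apply (D : A →ₗ[ℝ] A) (p : A⟦X⟧) : idAddXEquiv D p = idAddX D p := rfl

theorem idAddXEquiv_C (D : A →ₗ[ℝ] A) (a : A) :
    idAddXEquiv D (PowerSeries.C a) = PowerSeries.C a + PowerSeries.X * PowerSeries.C (D a) := by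
  ext n
  rw [idAddXEquiv_apply]
  cases n with
  | zero => simp [coeff_zero_idAddX]
  | succ n =>
    rw [coeff_succ_idAddX, map_add, PowerSeries.coeff_succ_X_mul, PowerSeries.coeff_C (n := n),
      PowerSeries.coeff_C (n := n)]
    split_ifs <;> simp

theorem coeff_idAddXEquiv_symm (D : A →ₗ[ℝ] A) (q : A⟦X⟧) (n : ℕ) :
    PowerSeries.coeff (n + 1) ((idAddXEquiv D).symm q) =
      PowerSeries.coeff (n + 1) q - D (PowerSeries.coeff n ((idAddXEquiv D).symm q)) := by
  have h := coeff_succ_idAddX D ((idAddXEquiv D).symm q) n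
  rw [← idAddXEquiv_apply, LinearEquiv.apply_symm_apply] at h
  rw [h, add_sub_cancel_right]

theorem coeff_zero_idAddXEquiv_symm (D : A →ₗ[ℝ] A) (q : A⟦X⟧) :
    PowerSeries.coeff 0 ((idAddXEquiv D).symm q) = PowerSeries.coeff 0 q := by
  rw [← coeff_zero_idAddX D, ← idAddXEquiv_apply, LinearEquiv.apply_symm_apply]

end PowerSeriesOperators

/-! ### Conjugating a star product by `id + ε D`, and its first-order term. -/

section Transport

variable {d : ℕ} {M : Type*} [TopologicalSpace M] [ChartedSpace (Eucl d) M]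

open PowerSeries (C coeff)

theorem StarProduct.one_star' (S : StarProduct d M) (p : (Smooth d M)⟦X⟧) : S.star 1 p = p := by
  have : S.star 1 = LinearMap.id := linearMap_ext_C fun f => S.one_star f
  rw [this, LinearMap.id_apply]

theorem StarProduct.star_one' (S : StarProduct d M) (p : (Smooth d M)⟦X⟧) : S.star p 1 = p := by
  have : S.star.flip 1 = LinearMap.id := linearMap_ext_C fun f => S.star_one f
  exact congrArg (fun T : (Smooth d M)⟦X⟧ →ₗ[ℝ⟦X⟧] (Smooth d M)⟦X⟧ => T p) this

/-- Associativity is given on constants only; it extends one argument at a time, since both sides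
are `ℝ⟦ε⟧`-linear in each slot. -/
theorem StarProduct.star_assoc' (S : StarProduct d M) (p q r : (Smooth d M)⟦X⟧) :
    S.star (S.star p q) r = S.star p (S.star q r) := by
  have h1 : ∀ (f g : Smooth d M) r,
      S.star (S.star (C f) (C g)) r = S.star (C f) (S.star (C g) r) := fun f g r =>
    LinearMap.congr_fun (linearMap_ext_C (T := S.star (S.star (C f) (C g)))
      (T' := S.star (C f) ∘ₗ S.star (C g)) fun h => S.star_assoc f g h) r
  have h2 : ∀ (f : Smooth d M) q r,
      S.star (S.star (C f) q) r = S.star (C f) (S.star q r) := fun f q r =>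
    LinearMap.congr_fun (linearMap_ext_C (T := S.star.flip r ∘ₗ S.star (C f))
      (T' := S.star (C f) ∘ₗ S.star.flip r) fun g => h1 f g r) q
  exact LinearMap.congr_fun (linearMap_ext_C (T := S.star.flip r ∘ₗ S.star.flip q)
      (T' := S.star.flip (S.star q r)) fun f => h2 f q r) p

/-- The product `𝒟⁻¹(𝒟 f ⋆ 𝒟 g)`. -/
def transportMul (S : StarProduct d M) (E : (Smooth d M)⟦X⟧ ≃ₗ[ℝ⟦X⟧] (Smooth d M)⟦X⟧) :
    (Smooth d M)⟦X⟧ →ₗ[ℝ⟦X⟧] (Smooth d M)⟦X⟧ →ₗ[ℝ⟦X⟧] (Smooth d M)⟦X⟧ :=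
  (S.star.compl₁₂ E.toLinearMap E.toLinearMap).compr₂ E.symm.toLinearMap

theorem transportMul_apply (S : StarProduct d M)
    (E : (Smooth d M)⟦X⟧ ≃ₗ[ℝ⟦X⟧] (Smooth d M)⟦X⟧) (p q : (Smooth d M)⟦X⟧) :
    transportMul S E p q = E.symm (S.star (E p) (E q)) := rfl

theorem coeff_star (S : StarProduct d M) (p q : (Smooth d M)⟦X⟧) (n : ℕ) :
    coeff n (S.star p q) = ∑ ij ∈ antidiagonal n, ∑ kl ∈ antidiagonal ij.1,
      S.B kl.1 (coeff kl.2 p) (coeff ij.2 q) := by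
  rw [coeff_linearMap_apply]
  refine Finset.sum_congr rfl fun ij _ => ?_
  exact coeff_linearMap_apply (S.star.flip (C (coeff ij.2 q))) p ij.1

theorem coeff_zero_star' (S : StarProduct d M) (p q : (Smooth d M)⟦X⟧) :
    coeff 0 (S.star p q) = coeff 0 p * coeff 0 q := by
  rw [coeff_star]
  simp
  exact S.coeff_zero_star _ _

theorem StarProduct.isBidifferentialOperator_B (S : StarProduct d M) (i : ℕ) :
    IsBidifferentialOperator (S.B i) := by
  rcases Nat.eq_zero_or_pos i with rfl | hi
  · have : S.B 0 = fun f g => f * g := funext fun f => funext fun g => S.coeff_zero_star f g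
    rw [this]
    exact IsBidifferentialOperator.mul
  · exact S.bidifferential i hi

theorem isDifferentialOperator_term_idAddX {D : Smooth d M →ₗ[ℝ] Smooth d M}
    (hD : IsDifferentialOperator D) (i : ℕ) :
    IsDifferentialOperator (term (idAddXEquiv D) i) := by
  match i with
  | 0 =>
    have : term (idAddXEquiv D) 0 = fun f => f := funext fun f => by
      simp [term, idAddXEquiv_C]
    rw [this]
    exact IsDifferentialOperator.id
  | 1 =>
    have : term (idAddXEquiv D) 1 = D := funext fun f => by
      simp [term, idAddXEquiv_C]
    rwa [this]
  | i + 2 =>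
    have : term (idAddXEquiv D) (i + 2) = fun _ => 0 := funext fun f => by
      rw [term, idAddXEquiv_apply, coeff_succ_idAddX]
      simp
    rw [this]
    exact IsDifferentialOperator.zero

theorem isDifferentialOperator_term_idAddX_symm {D : Smooth d M →ₗ[ℝ] Smooth d M}
    (hD : IsDifferentialOperator D) (i : ℕ) :
    IsDifferentialOperator (term (idAddXEquiv D).symm i) := by
  induction i with
  | zero =>
    have : term (idAddXEquiv D).symm 0 = fun f => f := funext fun f => by
      rw [term, coeff_zero_idAddXEquiv_symm]
      simp
    rw [this]
    exact IsDifferentialOperator.id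
  | succ i ih =>
    have : term (idAddXEquiv D).symm (i + 1) = fun f => -D (term (idAddXEquiv D).symm i f) :=
      funext fun f => by
        rw [term, coeff_idAddXEquiv_symm, PowerSeries.coeff_C, if_neg (Nat.succ_ne_zero i),
          zero_sub]
        rfl
    rw [this]
    exact (hD.comp ih).neg

/-- Each coefficient is a finite sum of compositions of the `B_i` with terms of `E` and of its
inverse, so finite order survives. -/
theorem isBidifferentialOperator_transportMul (S : StarProduct d M)
    {E : (Smooth d M)⟦X⟧ ≃ₗ[ℝ⟦X⟧] (Smooth d M)⟦X⟧}
    (hE : ∀ i, IsDifferentialOperator (term E i))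
    (hE' : ∀ i, IsDifferentialOperator (term E.symm i)) (n : ℕ) :
    IsBidifferentialOperator fun f g : Smooth d M => coeff n (transportMul S E (C f) (C g)) := by
  have : (fun f g : Smooth d M => coeff n (transportMul S E (C f) (C g))) = fun f g =>
      ∑ ab ∈ antidiagonal n, term E.symm ab.1 (∑ ij ∈ antidiagonal ab.2,
        ∑ kl ∈ antidiagonal ij.1, S.B kl.1 (term E kl.2 f) (term E ij.2 g)) := by
    funext f g
    rw [transportMul_apply]
    refine (coeff_linearMap_apply E.symm.toLinearMap _ n).trans ?_
    refine Finset.sum_congr rfl fun ab _ => ?_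
    rw [coeff_star]
    rfl
  rw [this]
  exact IsBidifferentialOperator.sum _ fun ab _ => (IsBidifferentialOperator.sum _ fun ij _ =>
    IsBidifferentialOperator.sum _ fun kl _ =>
      (S.isBidifferentialOperator_B kl.1).comp (hE kl.2) (hE ij.2)).comp_left (hE' ab.1)

/-- The star product `𝒟⁻¹(𝒟 f ⋆ 𝒟 g)` for `𝒟 = id + ε D`, `D` a differential operator. -/
def transport (S : StarProduct d M) (D : Smooth d M →ₗ[ℝ] Smooth d M)
    (hD : IsDifferentialOperator D) (hD1 : D 1 = 0) : StarProduct d M where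
  star := transportMul S (idAddXEquiv D)
  coeff_zero_star f g := by
    rw [transportMul_apply, coeff_zero_idAddXEquiv_symm, coeff_zero_star', idAddXEquiv_apply,
      idAddXEquiv_apply, coeff_zero_idAddX, coeff_zero_idAddX]
    simp
  star_assoc f g h := by
    simp only [transportMul_apply, LinearEquiv.apply_symm_apply, S.star_assoc']
  one_star f := by
    have h1 : idAddXEquiv D 1 = 1 := by
      have := idAddXEquiv_C D 1
      rwa [hD1, map_zero, mul_zero, add_zero, map_one] at this
    rw [transportMul_apply, h1, S.one_star', LinearEquiv.symm_apply_apply]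
  star_one f := by
    have h1 : idAddXEquiv D 1 = 1 := by
      have := idAddXEquiv_C D 1
      rwa [hD1, map_zero, mul_zero, add_zero, map_one] at this
    rw [transportMul_apply, h1, S.star_one', LinearEquiv.symm_apply_apply]
  bidifferential i _ := isBidifferentialOperator_transportMul S
    (isDifferentialOperator_term_idAddX hD) (isDifferentialOperator_term_idAddX_symm hD) i

theorem term_zero_idAddXEquiv (D : Smooth d M →ₗ[ℝ] Smooth d M) (f : Smooth d M) :
    term (idAddXEquiv D) 0 f = f := by
  rw [term, idAddXEquiv_apply, coeff_zero_idAddX]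
  simp

theorem term_one_idAddXEquiv (D : Smooth d M →ₗ[ℝ] Smooth d M) (f : Smooth d M) :
    term (idAddXEquiv D) 1 f = D f := by
  rw [term, idAddXEquiv_apply, coeff_succ_idAddX]
  simp [PowerSeries.coeff_C]

theorem coeff_one_star (S : StarProduct d M) (p q : (Smooth d M)⟦X⟧) :
    coeff 1 (S.star p q) =
      S.B 1 (coeff 0 p) (coeff 0 q) + coeff 1 p * coeff 0 q + coeff 0 p * coeff 1 q := by
  have h0 : ∀ f g, S.B 0 f g = f * g := S.coeff_zero_star
  rw [coeff_star]
  simp [Finset.Nat.antidiagonal_succ, h0]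
  ring

theorem StarProduct.B_one_cocycle (S : StarProduct d M) (f g h : Smooth d M) :
    f * S.B 1 g h - S.B 1 (f * g) h + S.B 1 f (g * h) - S.B 1 f g * h = 0 := by
  have := congrArg (coeff 1) (S.star_assoc f g h)
  rw [coeff_one_star S _ (C h), coeff_one_star S (C f) (S.star _ _), coeff_zero_star',
    coeff_zero_star'] at this
  change S.B 1 _ _ + S.B 1 f g * _ + _ = S.B 1 _ _ + _ + _ * S.B 1 g h at this
  simp [PowerSeries.coeff_C] at this
  linear_combination -this

theorem StarProduct.B_one_one_left (S : StarProduct d M) (g : Smooth d M) : S.B 1 1 g = 0 := by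
  have := S.one_star g
  rw [← map_one C] at this
  rw [StarProduct.B, this]
  simp

theorem StarProduct.B_one_one_right (S : StarProduct d M) (g : Smooth d M) : S.B 1 g 1 = 0 := by
  have := S.star_one g
  rw [← map_one C] at this
  rw [StarProduct.B, this]
  simp

theorem transport_B_one (S : StarProduct d M) (D : Smooth d M →ₗ[ℝ] Smooth d M)
    (hD : IsDifferentialOperator D) (hD1 : D 1 = 0) (f g : Smooth d M) :
    (transport S D hD hD1).B 1 f g = S.B 1 f g + D f * g + f * D g - D (f * g) := by
  change coeff 1 ((idAddXEquiv D).symm (S.star (idAddXEquiv D (C f)) (idAddXEquiv D (C g)))) = _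
  rw [coeff_idAddXEquiv_symm, coeff_zero_idAddXEquiv_symm, coeff_zero_star', coeff_one_star]
  change S.B 1 (term _ 0 f) (term _ 0 g) + term _ 1 f * term _ 0 g + term _ 0 f * term _ 1 g -
    D (term _ 0 f * term _ 0 g) = _
  simp only [term_zero_idAddXEquiv, term_one_idAddXEquiv]

/-- The symmetric part of the first-order term of a star product. -/
def StarProduct.symmPart (S : StarProduct d M) (f g : Smooth d M) : Smooth d M :=
  (1 / 2 : ℝ) • (S.B 1 f g + S.B 1 g f)

theorem StarProduct.isSymmetricCocycle_symmPart (S : StarProduct d M) :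
    IsSymmetricCocycle S.symmPart where
  symm f g := by rw [symmPart, symmPart, add_comm]
  one_left g := by rw [symmPart, S.B_one_one_left, S.B_one_one_right, add_zero, smul_zero]
  cocycle f g h := by
    have h1 := S.B_one_cocycle f g h
    -- Reversing the arguments changes the sign of the cocycle identity for the opposite bilinear
    -- map, so subtracting this one gives the identity for the symmetrization.
    have h2 := S.B_one_cocycle h g f
    rw [mul_comm h g, mul_comm g f] at h2
    simp only [symmPart, mul_smul_comm, smul_mul_assoc, ← smul_sub, ← smul_add]
    refine smul_eq_zero_of_right _ ?_
    linear_combination h1 - h2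

end Transport

end StarProd

end

theorem mainTheorem4 (d : ℕ) (M : Type*) [TopologicalSpace M] [T2Space M]
    [SecondCountableTopology M] [ChartedSpace (StarProd.Eucl d) M]
    [IsManifold 𝓘(ℝ, StarProd.Eucl d) ∞ M]
    (c : Quotient (StarProd.setoid d M)) (S : StarProd.StarProduct d M)
    (hS : Quotient.mk (StarProd.setoid d M) S = c) :
    ∃ S' : StarProd.StarProduct d M,
      Quotient.mk (StarProd.setoid d M) S' = c ∧
      (∀ f g : StarProd.Smooth d M, S'.B 1 f g = -S'.B 1 g f) ∧
      ∃ D : (StarProd.Smooth d M)⟦X⟧ ≃ₗ[ℝ⟦X⟧] (StarProd.Smooth d M)⟦X⟧,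
        StarProd.IsEquivalence D S S' ∧
        (∀ i : ℕ, 1 ≤ i → StarProd.IsDifferentialOperator (StarProd.term D i)) ∧
        ∀ f g : StarProd.Smooth d M,
          StarProd.term D 1 (f * g) =
            StarProd.term D 1 f * g + f * StarProd.term D 1 g +
              (1 / 2 : ℝ) • (S.B 1 f g + S.B 1 g f) := by
  -- Together with second countability this yields σ-compactness, required for the partition of
  -- unity.
  have : LocallyCompactSpace M := ChartedSpace.locallyCompactSpace (StarProd.Eucl d) M
  have hB := S.isSymmetricCocycle_symmPart
  have hBd : StarProd.IsBidifferentialOperator S.symmPart :=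
    ((S.isBidifferentialOperator_B 1).add (S.isBidifferentialOperator_B 1).swap).const_smul _
  obtain ⟨D, hD⟩ := StarProd.exists_linear_primitive hB hBd
  have hDd := StarProd.isDifferentialOperator_of_coboundary hB hBd D hD
  -- Ensures that `id + ε D` fixes `1`, so the transported product keeps its unit.
  have hD1 : D 1 = 0 := by
    have := hD 1 1
    rw [hB.one_left] at this
    simpa using this
  have hequiv : StarProd.IsEquivalence (StarProd.idAddXEquiv D) S
      (StarProd.transport S D hDd hD1) := ⟨StarProd.term_zero_idAddXEquiv D, fun _ _ => rfl⟩
  have h2 : ∀ u : StarProd.Smooth d M, (1 / 2 : ℝ) • (u + u) = u := fun u => by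
    rw [← two_smul ℝ u, smul_smul]
    norm_num
  refine ⟨StarProd.transport S D hDd hD1, ?_, fun f g => ?_, StarProd.idAddXEquiv D, hequiv,
    fun i _ => StarProd.isDifferentialOperator_term_idAddX hDd i, fun f g => ?_⟩
  · rw [← hS]
    exact Quotient.sound (s := StarProd.setoid d M)
      (StarProd.equivalent_equivalence.symm ⟨_, hequiv⟩)
  -- Substituting the equation for `D` leaves `B_1` minus its symmetric part.
  · rw [StarProd.transport_B_one, StarProd.transport_B_one, mul_comm g f, hD,
      StarProd.StarProduct.symmPart]
    have h : S.B 1 f g + S.B 1 g f =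
        (1 / 2 : ℝ) • (S.B 1 f g + S.B 1 g f) + (1 / 2 : ℝ) • (S.B 1 f g + S.B 1 g f) := by
      rw [← smul_add, h2]
    linear_combination h
  · simp only [StarProd.term_one_idAddXEquiv]
    exact hD f g
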